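/- Theorem (functional Urysohn inequality). Let $n\ge 1$ and let $\mathrm{Conv}_{\rm c}(\mathbb{R}^n)$ be the set of convex functions $\psi:\mathbb{R}^n\to(-\infty,\infty]$ that are proper, lower semicontinuous and coercive, i.e. $\lim_{|x|\to\infty}\psi(x)=\infty$. Write $\mathcal{L}\psi(x)=\sup_{y\in\mathbb{R}^n}(\langle x,y\rangle-\psi(y))$ for the convex conjugate, and let $\mathrm{LC}_{\rm c}(\mathbb{R}^n)=\{e^{-\psi}:\psi\in\mathrm{Conv}_{\rm c}(\mathbb{R}^n)\}$ with $e^{-\infty}=0$. For $\psi\in\mathrm{Conv}_{\rm c}(\mathbb{R}^n)$ the rotational epi-symmetrization $\psi_{\rm rot}$ is, for $n\ge 2$, the function in $\mathrm{Conv}_{\rm c}(\mathbb{R}^n)$ with $$\mathcal{L}\psi_{\rm rot}(x)=\int_{\mathrm{SO}(n)}\mathcal{L}\psi(\vartheta^{-1}x)\,\mathrm{d}\vartheta\qquad(x\in\mathbb{R}^n),$$ where the integration is with respect to the Haar probability measure on $\mathrm{SO}(n)$; for $n=1$ it is the function $\psi_{\rm rot}(x)=\tfrac12\inf_{y\in\mathbb{R}}\big(\psi(2x-y)+\psi(-y)\big)$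 in $\mathrm{Conv}_{\rm c}(\mathbb{R})$. For $f=e^{-\psi}\in\mathrm{LC}_{\rm c}(\mathbb{R}^n)$ the rotational hypo-symmetrization is $f_{\rm rot}=e^{-\psi_{\rm rot}}$. Then for every $f\in\mathrm{LC}_{\rm c}(\mathbb{R}^n)$ the function $f_{\rm rot}$ exists and is unique, $f$ and $f_{\rm rot}$ are integrable, and $$\int_{\mathbb{R}^n} f(x)\,\mathrm{d}x\;\le\;\int_{\mathbb{R}^n} f_{\rm rot}(x)\,\mathrm{d}x .$$ -/

import Mathlib

open MeasureTheory Filter Topology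

noncomputable section

namespace FunctionalUrysohn

/-- Euclidean space `ℝⁿ`. -/
abbrev E (n : ℕ) : Type := EuclideanSpace ℝ (Fin n)

/-! ### Coercive convex functions -/

/-- Membership in `Conv_c(ℝⁿ)`: convex functions `ψ : ℝⁿ → (-∞, ∞]` that are coercive, proper and
lower semicontinuous. -/
structure IsConvC {n : ℕ} (ψ : E n → EReal) : Prop where
  ne_bot : ∀ x, ψ x ≠ ⊥
  convex : ∀ x y : E n, ∀ a b : ℝ, 0 < a → 0 < b → a + b = 1 →
    ψ (a • x + b • y) ≤ (a : EReal) * ψ x + (b : EReal) * ψ y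
  coercive : Tendsto ψ (Bornology.cobounded (E n)) (𝓝 ⊤)
  proper : ∃ x, ψ x < ⊤
  lsc : LowerSemicontinuous ψ

/-- The convex conjugate (Legendre-Fenchel transform) of `ψ`. -/
def conj {n : ℕ} (ψ : E n → EReal) (x : E n) : EReal :=
  ⨆ y : E n, (((inner ℝ x y : ℝ) : EReal) - ψ y)

/-- The infimal convolution (epi-sum) of `ψ₁` and `ψ₂`. -/
def infConv {n : ℕ} (ψ₁ ψ₂ : E n → EReal) (x : E n) : EReal :=
  ⨅ y : E n, (ψ₁ (x - y) + ψ₂ y)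

/-- The epi-multiplication `x ↦ c ψ(x / c)`, used for `c > 0`. -/
def epiMul {n : ℕ} (c : ℝ) (ψ : E n → EReal) (x : E n) : EReal :=
  (c : EReal) * ψ (c⁻¹ • x)

/-! ### The rotation group and its Haar probability measure -/

/-- The rotation group `SO(n)`, with the topology of matrices. -/
abbrev SO (n : ℕ) : Type := Matrix.specialOrthogonalGroup (Fin n) ℝ

instance instIsTopologicalGroupSO (n : ℕ) : IsTopologicalGroup (SO n) where
  continuous_inv := by
    refine Continuous.subtype_mk (f := fun A : SO n => (A : Matrix (Fin n) (Fin n) ℝ).transpose)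
      ?_ (fun A => (A⁻¹).2)
    exact continuous_subtype_val.matrix_transpose

instance instCompactSpaceSO (n : ℕ) : CompactSpace (SO n) := by
  apply isCompact_iff_compactSpace.mp
  have hK : IsCompact (Set.univ.pi fun _ : Fin n => Set.univ.pi fun _ : Fin n =>
      Set.Icc (-1 : ℝ) 1) :=
    isCompact_univ_pi fun _ => isCompact_univ_pi fun _ => isCompact_Icc
  have hC : IsClosed {A : Matrix (Fin n) (Fin n) ℝ | A * A.transpose = 1 ∧ A.det = 1} :=
    (isClosed_eq (by fun_prop) continuous_const).inter
      (isClosed_eq (by fun_prop) continuous_const)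
  have hS : (Matrix.specialOrthogonalGroup (Fin n) ℝ : Set (Matrix (Fin n) (Fin n) ℝ)) =
      {A | A * A.transpose = 1 ∧ A.det = 1} := by
    ext A
    simp only [SetLike.mem_coe, Matrix.mem_specialOrthogonalGroup_iff,
      Matrix.mem_orthogonalGroup_iff, Set.mem_ofPred_eq]
  rw [hS]
  refine IsCompact.of_isClosed_subset hK hC ?_
  rintro A ⟨hA, -⟩ i - j -
  have h1 : ∑ k, A i k * A i k = 1 := by
    have := congrFun (congrFun hA i) i
    simpa [Matrix.mul_apply] using this
  have h2 : A i j * A i j ≤ 1 := by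
    rw [← h1]
    exact Finset.single_le_sum (f := fun k => A i k * A i k)
      (fun k _ => mul_self_nonneg _) (Finset.mem_univ j)
  exact ⟨by nlinarith, by nlinarith⟩

instance instMeasurableSpaceSO (n : ℕ) : MeasurableSpace (SO n) := borel _

instance instBorelSpaceSO (n : ℕ) : BorelSpace (SO n) := ⟨rfl⟩

/-- The Haar probability measure on `SO(n)`. -/
def haarSO (n : ℕ) : Measure (SO n) := Measure.haarMeasure ⊤

theorem haarSO_univ (n : ℕ) : haarSO n Set.univ = 1 := by
  have h := Measure.haarMeasure_self (G := SO n) (K₀ := ⊤)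
  simpa [haarSO] using h

/-- The rotation of `x ∈ ℝⁿ` by `θ ∈ SO(n)`. -/
def rotate {n : ℕ} (θ : SO n) (x : E n) : E n :=
  Matrix.toEuclideanLin (θ : Matrix (Fin n) (Fin n) ℝ) x

/-! ### Rotational epi-symmetrization -/

/-- The integral of an extended real valued function whose negative part has finite integral:
the integral of the positive part minus the integral of the negative part. -/
def integralE {Ω : Type*} [MeasurableSpace Ω] (μ : Measure Ω) (h : Ω → EReal) : EReal :=
  ((∫⁻ ω, (h ω).toENNReal ∂μ : ENNReal) : EReal) -
    ((∫⁻ ω, (-h ω).toENNReal ∂μ : ENNReal) : EReal)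

/-- The rotational average `x ↦ ∫_{SO(n)} φ(θ⁻¹ x) dθ`. -/
def rotAverage {n : ℕ} (φ : E n → EReal) (x : E n) : EReal :=
  integralE (haarSO n) fun θ => φ (rotate θ⁻¹ x)

/-- `φ` is the rotational epi-symmetrization `ψ_rot` of `ψ`: for `n ≥ 2` it is the function in
`Conv_c(ℝⁿ)` whose conjugate is the rotational average of the conjugate of `ψ`; for `n = 1` it is
the epi-mean of `ψ` and its reflection. -/
structure IsRotEpiSymm {n : ℕ} (ψ φ : E n → EReal) : Prop where
  isConvC : IsConvC φ
  conj_eq : 2 ≤ n → ∀ x, conj φ x = rotAverage (conj ψ) x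
  eq_one_dim : n = 1 → φ = epiMul (1 / 2) (infConv ψ fun x => ψ (-x))

/-! ### Coercive log-concave functions -/

/-- The function `e^{-ψ} : ℝⁿ → [0, ∞)`, with `e^{-∞} = 0`, for `ψ : ℝⁿ → (-∞, ∞]`. -/
def expNeg {n : ℕ} (ψ : E n → EReal) (x : E n) : ℝ :=
  (EReal.exp (-ψ x)).toReal

/-- `LC_c(ℝⁿ)`, the coercive log-concave functions. -/
def LCc (n : ℕ) : Set (E n → ℝ) := {f | ∃ ψ : E n → EReal, IsConvC ψ ∧ f = expNeg ψ}

/-- `g` is the rotational hypo-symmetrization `f_rot = e^{-ψ_rot}` of `f = e^{-ψ}`. -/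
def IsRotHypoSymm {n : ℕ} (f g : E n → ℝ) : Prop :=
  ∃ ψ φ : E n → EReal, IsConvC ψ ∧ f = expNeg ψ ∧ IsRotEpiSymm ψ φ ∧ g = expNeg φ

/-- The total mass functional `J`. -/
def totalMass {n : ℕ} (f : E n → ℝ) : ℝ := ∫ x, f x

end FunctionalUrysohn

end

namespace FunctionalUrysohn

/-! ### The Prékopa-Leindler inequality -/

/-! For finite `w`, put M(w) = ∫ e^{-w*}. Prékopa-Leindler makes M log-concave in `w`, so its
superlevel sets are convex (`convex_setOf_le_massConj`). M is also monotone and invariant under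
rotations. A rotational average of `u` is a limit of convex combinations of rotated copies of `u`,
all of mass M(u), so its mass is at least M(u) (`massConj_le_massConj_average`). With u = ψ* and u*
= ψ, this is the inequality for n ≥ 2. Since ψ* may be infinite, it is approximated from below by
conjugates of truncations of ψ, which are finite and Lipschitz (`IsConvC.exists_approx`). A
Lipschitz function divided by 1 + ‖x‖ is bounded, so the average becomes a Bochner integral in a
Banach space. It lies in the closure of a convex superlevel set, and a penalty δ(1 + ‖x‖) with δ → 0
removes the closure (`le_massConj_of_forall_add`). For n ≥ 2, existence and uniqueness of ψ_rot
follow from Fenchel-Moreau (`conj_conj`). For n = 1, Prékopa-Leindler with weights 1/2 applies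
directly to ψ and its reflection. Integrability comes from the linear growth of coercive convex
functions. -/

theorem geom_mean_le_arith_mean_ennreal {a b : ℝ} (ha : 0 < a) (hb : 0 < b) (hab : a + b = 1)
    (F G : ENNReal) : F ^ a * G ^ b ≤ ENNReal.ofReal a * F + ENNReal.ofReal b * G := by
  have hpq : (a⁻¹).HolderConjugate b⁻¹ := by
    rw [Real.holderConjugate_iff]
    exact ⟨(one_lt_inv₀ ha).2 (by linarith), by simpa using hab⟩
  have h := ENNReal.young_inequality (F ^ a) (G ^ b) hpq
  rw [← ENNReal.rpow_mul, ← ENNReal.rpow_mul, mul_inv_cancel₀ ha.ne', mul_inv_cancel₀ hb.ne',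
    ENNReal.rpow_one, ENNReal.rpow_one, ENNReal.ofReal_inv_of_pos ha, ENNReal.ofReal_inv_of_pos hb,
    div_eq_mul_inv, div_eq_mul_inv, inv_inv, inv_inv] at h
  rwa [mul_comm (ENNReal.ofReal a), mul_comm (ENNReal.ofReal b)]

open scoped Pointwise in
/-- The one-dimensional Brunn-Minkowski inequality for nonempty compact sets. -/
theorem volume_add_le_of_isCompact {a b : ℝ} (ha : 0 < a) (hb : 0 < b) {A B C : Set ℝ}
    (hA : IsCompact A) (hB : IsCompact B) (hA0 : A.Nonempty) (hB0 : B.Nonempty)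
    (hC : ∀ x ∈ A, ∀ y ∈ B, a * x + b * y ∈ C) :
    ENNReal.ofReal a * volume A + ENNReal.ofReal b * volume B ≤ volume C := by
  -- With α = max A and β = min B, the sets aA + bβ and aα + bB both lie in C and meet only at aα +
  -- bβ, the first lying to its left and the second to its right.
  obtain ⟨α, hα, hαm⟩ := hA.exists_isGreatest hA0
  obtain ⟨β, hβ, hβm⟩ := hB.exists_isLeast hB0
  have himg : ∀ {c d : ℝ}, 0 < c → ∀ S : Set ℝ,
      volume ((fun x => c * x + d) '' S) = ENNReal.ofReal c * volume S := by
    intro c d hc S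
    have h1 : (fun x => c * x + d) '' S = (fun x => x + d) '' (c • S) := by
      rw [← Set.image_smul, Set.image_image]; rfl
    rw [h1, Set.image_add_right, measure_preimage_add_right, Measure.addHaar_smul]
    simp [abs_of_pos hc]
  have hAc : IsCompact ((fun x => a * x + b * β) '' A) := hA.image (by fun_prop)
  have hBc : IsCompact ((fun y => b * y + a * α) '' B) := hB.image (by fun_prop)
  have hdisj : AEDisjoint volume ((fun x => a * x + b * β) '' A)
      ((fun y => b * y + a * α) '' B) := by
    refine measure_mono_null (t := {a * α + b * β}) ?_ (by simp)
    rintro z ⟨⟨x, hx, rfl⟩, y, hy, hxy⟩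
    have h1 := mul_le_mul_of_nonneg_left (hαm hx) ha.le
    have h2 := mul_le_mul_of_nonneg_left (hβm hy) hb.le
    simp only [Set.mem_singleton_iff] at hxy ⊢
    linarith
  rw [← himg (d := b * β) ha A, ← himg (d := a * α) hb B,
    ← measure_union₀ hBc.measurableSet.nullMeasurableSet hdisj]
  refine measure_mono (Set.union_subset ?_ ?_)
  · rintro _ ⟨x, hx, rfl⟩
    exact hC x hx β hβ
  · rintro _ ⟨y, hy, rfl⟩
    simpa [add_comm] using hC α hα y hy

/-- The one-dimensional Brunn-Minkowski inequality for nonempty measurable sets. -/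
theorem volume_add_le {a b : ℝ} (ha : 0 < a) (hb : 0 < b) {A B C : Set ℝ}
    (hA : MeasurableSet A) (hB : MeasurableSet B) (hA0 : A.Nonempty) (hB0 : B.Nonempty)
    (hC : ∀ x ∈ A, ∀ y ∈ B, a * x + b * y ∈ C) :
    ENNReal.ofReal a * volume A + ENNReal.ofReal b * volume B ≤ volume C := by
  obtain ⟨x₀, hx₀⟩ := hA0
  obtain ⟨y₀, hy₀⟩ := hB0
  have hsup : ∀ S : Set ℝ, MeasurableSet S → volume S =
      ⨆ K : {K : Set ℝ // K ⊆ S ∧ IsCompact K}, volume (K : Set ℝ) := by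
    intro S hS
    rw [hS.measure_eq_iSup_isCompact, iSup_subtype]
    simp only [iSup_and]
  rw [hsup A hA, hsup B hB, ENNReal.mul_iSup, ENNReal.mul_iSup]
  have : Nonempty {K : Set ℝ // K ⊆ A ∧ IsCompact K} := ⟨⟨∅, by simp⟩⟩
  have : Nonempty {K : Set ℝ // K ⊆ B ∧ IsCompact K} := ⟨⟨∅, by simp⟩⟩
  refine ENNReal.iSup_add_iSup_le ?_
  rintro ⟨K, hKA, hK⟩ ⟨L, hLB, hL⟩
  -- The inner compact sets may be empty; inserting `x₀` and `y₀` makes the compact case applicable.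
  refine le_trans (add_le_add (mul_le_mul_right (measure_mono (Set.subset_insert x₀ K)) _)
    (mul_le_mul_right (measure_mono (Set.subset_insert y₀ L)) _))
    (volume_add_le_of_isCompact ha hb (hK.insert x₀) (hL.insert y₀) (Set.insert_nonempty _ _)
      (Set.insert_nonempty _ _) ?_)
  intro x hx y hy
  exact hC x (Set.insert_subset hx₀ hKA hx) y (Set.insert_subset hy₀ hLB hy)

theorem lintegral_min_one_eq {X : Type*} [MeasurableSpace X] (μ : Measure X) {f : X → ENNReal}
    (hf : Measurable f) :
    ∫⁻ x, min (f x) 1 ∂μ = ∫⁻ t in Set.Ioo (0 : ℝ) 1, μ {x | ENNReal.ofReal t < f x} := by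
  have hfin : ∀ x, min (f x) 1 ≠ ⊤ := fun x => ne_top_of_le_ne_top ENNReal.one_ne_top
    (min_le_right _ _)
  have h := lintegral_eq_lintegral_meas_lt μ (f := fun x => (min (f x) 1).toReal)
    (ae_of_all _ fun _ => ENNReal.toReal_nonneg) (by fun_prop)
  simp only [ENNReal.ofReal_toReal (hfin _)] at h
  have hset : ∀ t : ℝ, 0 < t → {x | t < (min (f x) 1).toReal} =
      if t < 1 then {x | ENNReal.ofReal t < f x} else ∅ := by
    intro t ht
    ext x
    rw [Set.mem_ofPred_eq, ← ENNReal.ofReal_lt_iff_lt_toReal ht.le (hfin x), lt_min_iff]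
    split_ifs with h1 <;> simp [h1]
  rw [h, ← Set.Ioi_inter_Iio, Set.inter_comm, ← Measure.restrict_restrict measurableSet_Iio,
    ← lintegral_indicator measurableSet_Iio]
  refine setLIntegral_congr_fun measurableSet_Ioi fun t ht => ?_
  simp only [hset t ht, Set.indicator_apply, Set.mem_Iio]
  split_ifs <;> simp

/-- The Prékopa-Leindler inequality on a measure space. -/
def PrekopaLeindler (X : Type*) [AddCommGroup X] [Module ℝ X] [MeasureSpace X] : Prop :=
  ∀ (a b : ℝ), 0 < a → 0 < b → a + b = 1 → ∀ f g h : X → ENNReal,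
    Measurable f → Measurable g → Measurable h →
    (∀ x y, f x ^ a * g y ^ b ≤ h (a • x + b • y)) →
    (∫⁻ x, f x) ^ a * (∫⁻ x, g x) ^ b ≤ ∫⁻ x, h x

/-- Equal suprema make {f > t} and {g > t} nonempty for every t in (0, 1), and their weighted sum
lies in {h > t}. Integrating the one-dimensional Brunn-Minkowski inequality over t bounds ∫ h below
by the arithmetic mean, hence by the geometric mean. -/
theorem prekopaLeindler_real_of_iSup_eq_one {a b : ℝ} (ha : 0 < a) (hb : 0 < b) (hab : a + b = 1)
    {f g h : ℝ → ENNReal} (hf : Measurable f) (hg : Measurable g) (hh : Measurable h)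
    (hf1 : ⨆ x, f x = 1) (hg1 : ⨆ x, g x = 1)
    (hfg : ∀ x y, f x ^ a * g y ^ b ≤ h (a * x + b * y)) :
    (∫⁻ x, f x) ^ a * (∫⁻ x, g x) ^ b ≤ ∫⁻ x, h x := by
  have hfm : ∀ x, min (f x) 1 = f x := fun x => min_eq_left (hf1 ▸ le_iSup f x)
  have hgm : ∀ x, min (g x) 1 = g x := fun x => min_eq_left (hg1 ▸ le_iSup g x)
  have hF := lintegral_min_one_eq volume hf
  have hG := lintegral_min_one_eq volume hg
  have hH := lintegral_min_one_eq volume hh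
  simp only [hfm] at hF
  simp only [hgm] at hG
  refine (geom_mean_le_arith_mean_ennreal ha hb hab _ _).trans ?_
  refine le_trans ?_ (lintegral_mono (f := fun x => min (h x) 1) fun x => min_le_left _ _)
  have hmeas : Measurable fun t : ℝ => volume {x | ENNReal.ofReal t < f x} :=
    Antitone.measurable fun s t hst => measure_mono fun x hx =>
      (ENNReal.ofReal_le_ofReal hst).trans_lt hx
  have hmeas' : Measurable fun t : ℝ => volume {x | ENNReal.ofReal t < g x} :=
    Antitone.measurable fun s t hst => measure_mono fun x hx =>
      (ENNReal.ofReal_le_ofReal hst).trans_lt hx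
  rw [hF, hG, hH, ← lintegral_const_mul _ hmeas, ← lintegral_const_mul _ hmeas',
    ← lintegral_add_left (hmeas.const_mul _)]
  refine setLIntegral_mono' measurableSet_Ioo fun t ht => ?_
  have ht1 : ENNReal.ofReal t < 1 := by simpa using ht.2
  have hfn : ∃ x, ENNReal.ofReal t < f x := lt_iSup_iff.1 (hf1 ▸ ht1)
  have hgn : ∃ x, ENNReal.ofReal t < g x := lt_iSup_iff.1 (hg1 ▸ ht1)
  refine volume_add_le ha hb (measurableSet_lt measurable_const hf)
    (measurableSet_lt measurable_const hg) hfn hgn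
    fun x hx y hy => lt_of_lt_of_le ?_ (hfg x y)
  calc ENNReal.ofReal t = ENNReal.ofReal t ^ a * ENNReal.ofReal t ^ b := by
        rw [← ENNReal.rpow_add _ _ (by simpa using ht.1) ENNReal.ofReal_ne_top, hab,
          ENNReal.rpow_one]
    _ < f x ^ a * g y ^ b :=
        ENNReal.mul_lt_mul (ENNReal.rpow_lt_rpow hx ha) (ENNReal.rpow_lt_rpow hy hb)

/-- Homogeneity: `f` and `g` are divided by their suprema A and B, and `h` by A^a B^b. -/
theorem prekopaLeindler_real_of_bounded {a b : ℝ} (ha : 0 < a) (hb : 0 < b) (hab : a + b = 1)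
    {f g h : ℝ → ENNReal} (hf : Measurable f) (hg : Measurable g) (hh : Measurable h)
    (hft : ⨆ x, f x ≠ ⊤) (hgt : ⨆ x, g x ≠ ⊤)
    (hfg : ∀ x y, f x ^ a * g y ^ b ≤ h (a * x + b * y)) :
    (∫⁻ x, f x) ^ a * (∫⁻ x, g x) ^ b ≤ ∫⁻ x, h x := by
  set A := ⨆ x, f x with hA
  set B := ⨆ x, g x with hB
  by_cases hA0 : A = 0
  · have : ∀ x, f x = 0 := fun x => by simpa using (le_iSup f x).trans hA0.le
    simp [this, ENNReal.zero_rpow_of_pos ha]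
  by_cases hB0 : B = 0
  · have : ∀ x, g x = 0 := fun x => by simpa using (le_iSup g x).trans hB0.le
    simp [this, ENNReal.zero_rpow_of_pos hb]
  have key := prekopaLeindler_real_of_iSup_eq_one ha hb hab (hf.const_mul A⁻¹)
    (hg.const_mul B⁻¹) (hh.const_mul ((A⁻¹) ^ a * (B⁻¹) ^ b))
    (by rw [← ENNReal.mul_iSup, ← hA, ENNReal.inv_mul_cancel hA0 hft])
    (by rw [← ENNReal.mul_iSup, ← hB, ENNReal.inv_mul_cancel hB0 hgt]) (by
      intro x y
      rw [ENNReal.mul_rpow_of_nonneg _ _ ha.le, ENNReal.mul_rpow_of_nonneg _ _ hb.le,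
        mul_mul_mul_comm]
      exact mul_le_mul_right (hfg x y) _)
  rw [lintegral_const_mul _ hf, lintegral_const_mul _ hg, lintegral_const_mul _ hh,
    ENNReal.mul_rpow_of_nonneg _ _ ha.le, ENNReal.mul_rpow_of_nonneg _ _ hb.le,
    mul_mul_mul_comm] at key
  refine (ENNReal.mul_le_mul_iff_right ?_ ?_).1 key
  · refine mul_ne_zero ?_ ?_ <;> simp [ENNReal.rpow_eq_zero_iff, hft, hgt, ha.le, hb.le, not_lt.2]
  · refine ENNReal.mul_ne_top ?_ ?_ <;>
      simp [ENNReal.rpow_eq_top_iff, hA0, hB0, ha.le, hb.le, not_lt.2]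

theorem prekopaLeindler_real : PrekopaLeindler ℝ := by
  intro a b ha hb hab f g h hf hg hh hfg
  -- Vanishing integrals are split off because multiplication on `ENNReal` is discontinuous at (0,
  -- ∞), and a limit of products is taken below.
  by_cases hF0 : ∫⁻ x, f x = 0
  · simp [hF0, ENNReal.zero_rpow_of_pos ha]
  by_cases hG0 : ∫⁻ x, g x = 0
  · simp [hG0, ENNReal.zero_rpow_of_pos hb]
  have hlim : ∀ {u : ℝ → ENNReal} {c : ℝ}, Measurable u →
      Tendsto (fun N : ℕ => (∫⁻ x, min (u x) N) ^ c) atTop (𝓝 ((∫⁻ x, u x) ^ c)) := by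
    intro u c hu
    refine (ENNReal.continuous_rpow_const.tendsto _).comp
      (lintegral_tendsto_of_tendsto_of_monotone (fun N => by fun_prop)
        (ae_of_all _ fun x M N hMN => min_le_min_left _ (by exact_mod_cast hMN))
        (ae_of_all _ fun x => ?_))
    have := (tendsto_const_nhds (x := u x)).min ENNReal.tendsto_nat_nhds_top
    simpa using this
  refine le_of_tendsto (ENNReal.Tendsto.mul (hlim hf) (Or.inl ?_) (hlim hg) (Or.inl ?_))
    (Eventually.of_forall fun N => ?_)
  · simp [ENNReal.rpow_eq_zero_iff, hF0, ha.le, not_lt.2]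
  · simp [ENNReal.rpow_eq_zero_iff, hG0, hb.le, not_lt.2]
  · have hbd : ∀ u : ℝ → ENNReal, ⨆ x, min (u x) (N : ENNReal) ≠ ⊤ := fun u =>
      ne_top_of_le_ne_top (ENNReal.natCast_ne_top N) (iSup_le fun x => min_le_right _ _)
    refine prekopaLeindler_real_of_bounded ha hb hab (by fun_prop) (by fun_prop) hh (hbd f) (hbd g)
      fun x y => le_trans ?_ (hfg x y)
    exact mul_le_mul' (ENNReal.rpow_le_rpow (min_le_left _ _) ha.le)
      (ENNReal.rpow_le_rpow (min_le_left _ _) hb.le)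

/-- Tensorization: the inequality on the fibres over s, t and as + bt is exactly the hypothesis on X
for the fibre integrals. -/
theorem PrekopaLeindler.prod {X Y : Type*} [AddCommGroup X] [Module ℝ X] [MeasureSpace X]
    [AddCommGroup Y] [Module ℝ Y] [MeasureSpace Y] [SFinite (volume : Measure Y)]
    (hX : PrekopaLeindler X) (hY : PrekopaLeindler Y) : PrekopaLeindler (X × Y) := by
  intro a b ha hb hab f g h hf hg hh hfg
  rw [Measure.volume_eq_prod, lintegral_prod _ hf.aemeasurable, lintegral_prod _ hg.aemeasurable,
    lintegral_prod _ hh.aemeasurable]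
  refine hX a b ha hb hab _ _ _ hf.lintegral_prod_right' hg.lintegral_prod_right'
    hh.lintegral_prod_right' fun s t => ?_
  exact hY a b ha hb hab (fun y => f (s, y)) (fun y => g (t, y)) (fun y => h (a • s + b • t, y))
    (by fun_prop) (by fun_prop) (by fun_prop) fun x y => hfg (s, x) (t, y)

theorem PrekopaLeindler.of_measurableEquiv {X Y : Type*} [AddCommGroup X] [Module ℝ X]
    [MeasureSpace X] [AddCommGroup Y] [Module ℝ Y] [MeasureSpace Y]
    (hX : PrekopaLeindler X) (e : X ≃ᵐ Y) (he : MeasurePreserving e volume volume)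
    (hlin : ∀ (a b : ℝ) (x y : X), e (a • x + b • y) = a • e x + b • e y) :
    PrekopaLeindler Y := by
  intro a b ha hb hab f g h hf hg hh hfg
  rw [← he.lintegral_comp hf, ← he.lintegral_comp hg, ← he.lintegral_comp hh]
  refine hX a b ha hb hab _ _ _ (hf.comp e.measurable) (hg.comp e.measurable)
    (hh.comp e.measurable) fun x y => ?_
  rw [hlin]
  exact hfg _ _

theorem prekopaLeindler_fin : ∀ n : ℕ, PrekopaLeindler (Fin n → ℝ)
  | 0 => by
    intro a b ha hb hab f g h hf hg hh hfg
    have hv : (volume : Measure (Fin 0 → ℝ)) Set.univ = 1 := by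
      rw [← Set.pi_univ Set.univ, volume_pi_pi]; simp
    simp only [lintegral_unique, hv, mul_one]
    refine (hfg _ _).trans_eq (congrArg h (Subsingleton.elim _ _))
  | n + 1 => by
    refine (prekopaLeindler_real.prod (prekopaLeindler_fin n)).of_measurableEquiv
      (MeasurableEquiv.piFinSuccAbove (fun _ : Fin (n + 1) => ℝ) 0).symm
      ((volume_preserving_piFinSuccAbove (fun _ : Fin (n + 1) => ℝ) 0).symm _) ?_
    intro a b x y
    funext i
    refine Fin.cases ?_ (fun j => ?_) i <;> simp [MeasurableEquiv.piFinSuccAbove]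

theorem prekopaLeindler_euclidean (n : ℕ) : PrekopaLeindler (E n) :=
  (prekopaLeindler_fin n).of_measurableEquiv (MeasurableEquiv.toLp 2 (Fin n → ℝ))
    (EuclideanSpace.volume_preserving_symm_measurableEquiv_toLp (Fin n)).symm
    fun _ _ _ _ => rfl

/-! ### Extended real arithmetic -/

theorem coe_sub_le_comm {r : ℝ} {d e : EReal} (h : (r : EReal) - e ≤ d) : (r : EReal) - d ≤ e := by
  induction e with
  | bot => simp_all
  | top => exact le_top
  | coe e =>
    induction d with
    | bot => rw [← EReal.coe_sub] at h; exact absurd (le_bot_iff.1 h) (EReal.coe_ne_bot _)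
    | top => simp
    | coe d => norm_cast at h ⊢; linarith

theorem coe_sub_le_coe_iff {r c : ℝ} {e : EReal} :
    (r : EReal) - e ≤ c ↔ ((r - c : ℝ) : EReal) ≤ e := by
  rw [EReal.coe_sub]
  exact ⟨coe_sub_le_comm, coe_sub_le_comm⟩

theorem coe_mul_le_coe_mul {a : ℝ} (ha : 0 < a) {d e : EReal} (h : d ≤ e) :
    (a : EReal) * d ≤ (a : EReal) * e :=
  mul_le_mul_of_nonneg_left h (EReal.coe_nonneg.2 ha.le)

theorem coe_mul_ne_bot {a : ℝ} (ha : 0 < a) {d : EReal} (h : d ≠ ⊥) : (a : EReal) * d ≠ ⊥ := by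
  induction d with
  | bot => exact absurd rfl h
  | top => simp [EReal.coe_mul_top_of_pos ha]
  | coe d => rw [← EReal.coe_mul]; exact EReal.coe_ne_bot _

variable {n : ℕ}

/-! ### Convex conjugates -/

theorem inner_sub_le_conj (ψ : E n → EReal) (x y : E n) :
    ((inner ℝ x y : ℝ) : EReal) - ψ y ≤ conj ψ x :=
  le_iSup (fun y : E n => ((inner ℝ x y : ℝ) : EReal) - ψ y) y

theorem conj_anti {φ ψ : E n → EReal} (h : φ ≤ ψ) : conj ψ ≤ conj φ :=
  fun _ => iSup_mono fun y => EReal.sub_le_sub le_rfl (h y)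

theorem conj_conj_le (ψ : E n → EReal) : conj (conj ψ) ≤ ψ := by
  intro x
  refine iSup_le fun v => coe_sub_le_comm ?_
  rw [real_inner_comm]
  exact inner_sub_le_conj ψ v x

theorem conj_le_coe_iff {ψ : E n → EReal} {x : E n} {c : ℝ} :
    conj ψ x ≤ c ↔ ∀ y, ((inner ℝ x y - c : ℝ) : EReal) ≤ ψ y := by
  simp only [conj, iSup_le_iff, coe_sub_le_coe_iff]

theorem continuous_coe_sub_const {X : Type*} [TopologicalSpace X] {u : X → ℝ} (hu : Continuous u)
    (c : EReal) : Continuous fun x => (u x : EReal) - c := by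
  induction c with
  | bot => simpa using continuous_const
  | top => simpa using continuous_const
  | coe c =>
    simp only [← EReal.coe_sub]
    exact continuous_coe_real_ereal.comp (by fun_prop)

theorem lowerSemicontinuous_conj (ψ : E n → EReal) : LowerSemicontinuous (conj ψ) :=
  lowerSemicontinuous_iSup fun y =>
    (continuous_coe_sub_const (u := fun x : E n => inner ℝ x y) (by fun_prop)
      (ψ y)).lowerSemicontinuous

theorem measurable_conj (ψ : E n → EReal) : Measurable (conj ψ) :=
  (lowerSemicontinuous_conj ψ).measurable

theorem conj_convex (ψ : E n → EReal) (x y : E n) (a b : ℝ) (ha : 0 < a) (hb : 0 < b)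
    (hab : a + b = 1) :
    conj ψ (a • x + b • y) ≤ (a : EReal) * conj ψ x + (b : EReal) * conj ψ y := by
  refine iSup_le fun z => ?_
  refine le_trans ?_ (add_le_add (coe_mul_le_coe_mul ha (inner_sub_le_conj ψ x z))
    (coe_mul_le_coe_mul hb (inner_sub_le_conj ψ y z)))
  induction ψ z with
  | bot => simp [EReal.coe_mul_top_of_pos ha, EReal.coe_mul_top_of_pos hb]
  | top => simp
  | coe c =>
    norm_cast
    rw [inner_add_left, real_inner_smul_left, real_inner_smul_left]
    have hc : c = a * c + b * c := by rw [← add_mul, hab, one_mul]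
    linarith

/-- The Fenchel-Moreau theorem for proper functions with an affine minorant. -/
theorem conj_conj {φ : E n → EReal}
    (hconv : ∀ x y : E n, ∀ a b : ℝ, 0 < a → 0 < b → a + b = 1 →
      φ (a • x + b • y) ≤ (a : EReal) * φ x + (b : EReal) * φ y)
    (hlsc : LowerSemicontinuous φ) (hproper : ∃ x, φ x < ⊤)
    (hmin : ∃ (v : E n) (c : ℝ), ∀ x, ((inner ℝ v x - c : ℝ) : EReal) ≤ φ x) :
    conj (conj φ) = φ := by
  refine le_antisymm (conj_conj_le φ) fun x₀ => EReal.ge_of_forall_gt_iff_ge.1 fun t₀ ht₀ => ?_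
  have key : ∀ (v : E n) (c : ℝ), (∀ x, ((inner ℝ v x - c : ℝ) : EReal) ≤ φ x) →
      t₀ ≤ inner ℝ v x₀ - c → (t₀ : EReal) ≤ conj (conj φ) x₀ := by
    intro v c h ht
    refine le_trans ?_ (inner_sub_le_conj (conj φ) x₀ v)
    refine le_trans ?_ (EReal.sub_le_sub le_rfl (conj_le_coe_iff.2 h))
    rw [← EReal.coe_sub, real_inner_comm]
    exact EReal.coe_le_coe_iff.2 ht
  let epi : Set (E n × ℝ) := {p | φ p.1 ≤ p.2}
  have hepi : Convex ℝ epi := by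
    refine convex_iff_forall_pos.2 fun p hp q hq a b ha hb hab => ?_
    change φ _ ≤ ((a * p.2 + b * q.2 : ℝ) : EReal)
    refine (hconv p.1 q.1 a b ha hb hab).trans ?_
    rw [EReal.coe_add, EReal.coe_mul, EReal.coe_mul]
    exact add_le_add (coe_mul_le_coe_mul ha hp) (coe_mul_le_coe_mul hb hq)
  have hclosed : IsClosed epi :=
    (hlsc.isClosed_epigraph).preimage (f := fun p : E n × ℝ => (p.1, (p.2 : EReal)))
      (continuous_fst.prodMk (continuous_coe_real_ereal.comp continuous_snd))
  -- A point strictly below the graph is separated from the epigraph; a non-vertical hyperplane is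
  -- the graph of the required affine minorant.
  obtain ⟨l, s, hls, hl⟩ := geometric_hahn_banach_point_closed (x := (x₀, t₀)) hepi hclosed
    (not_le.2 ht₀)
  obtain ⟨v, hv⟩ : ∃ v : E n, ∀ x, l (x, 0) = inner ℝ v x :=
    ⟨(InnerProductSpace.toDual ℝ (E n)).symm (l.comp (ContinuousLinearMap.inl ℝ (E n) ℝ)),
      fun x => by simp⟩
  have hlform : ∀ (x : E n) (t : ℝ), l (x, t) = inner ℝ v x + t * l (0, 1) := by
    intro x t
    rw [← hv, ← smul_eq_mul, ← map_smul, ← map_add]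
    simp
  set c := l (0, 1) with hc
  have hls' : inner ℝ v x₀ + t₀ * c < s := by rw [← hlform]; exact hls
  have hl' : ∀ x (t : ℝ), φ x ≤ t → s < inner ℝ v x + t * c := fun x t h => by
    rw [← hlform]; exact hl (x, t) h
  obtain ⟨v₁, c₁, hmin⟩ := hmin
  have hcoe : ∀ x, φ x = ⊤ ∨ ∃ t : ℝ, φ x = t := by
    intro x
    have := hmin x
    revert this
    induction φ x with
    | bot => intro this; exact absurd (le_bot_iff.1 this) (EReal.coe_ne_bot _)
    | top => intro; exact Or.inl rfl
    | coe t => intro; exact Or.inr ⟨t, rfl⟩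
  have hc0 : 0 ≤ c := by
    obtain ⟨x₁, hx₁⟩ := hproper
    obtain ⟨t₁, ht₁⟩ := (hcoe x₁).resolve_left hx₁.ne
    by_contra! hneg
    have h := hl' x₁ (max t₁ ((s - inner ℝ v x₁) / c))
      (ht₁.le.trans (EReal.coe_le_coe_iff.2 (le_max_left _ _)))
    have h2 : max t₁ ((s - inner ℝ v x₁) / c) * c ≤ ((s - inner ℝ v x₁) / c) * c :=
      mul_le_mul_of_nonpos_right (le_max_right _ _) hneg.le
    rw [div_mul_cancel₀ _ hneg.ne] at h2
    linarith
  rcases hc0.eq_or_lt with hc0 | hc0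
  · -- the separating hyperplane is vertical
    rw [← hc0] at hls' hl'
    have hpos : 0 < s - inner ℝ v x₀ := by linarith
    obtain ⟨k, hk⟩ := exists_nat_ge ((t₀ - (inner ℝ v₁ x₀ - c₁)) / (s - inner ℝ v x₀))
    rw [div_le_iff₀ hpos] at hk
    -- The known minorant is tilted by k(s - ⟨v, x⟩), which is negative where φ is finite and
    -- positive at `x₀`; a large k lifts it above `t₀` there.
    refine key (v₁ - (k : ℝ) • v) (c₁ - k * s) (fun x => ?_) ?_
    · rcases hcoe x with h | ⟨t, h⟩
      · simp [h]
      · have h1 := hl' x t h.le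
        have h2 := hmin x
        rw [h, EReal.coe_le_coe_iff] at h2 ⊢
        rw [inner_sub_left, real_inner_smul_left]
        have : (0 : ℝ) ≤ k := k.cast_nonneg
        nlinarith
    · rw [inner_sub_left, real_inner_smul_left]
      linarith
  · refine key (-(c⁻¹ • v)) (-(c⁻¹ * s)) (fun x => ?_) ?_
    · rcases hcoe x with h | ⟨t, h⟩
      · simp [h]
      · have h1 := hl' x t h.le
        rw [h, EReal.coe_le_coe_iff, inner_neg_left, real_inner_smul_left]
        have h2 : c⁻¹ * (s - inner ℝ v x) ≤ t := by
          rw [inv_mul_le_iff₀ hc0]; linarith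
        linarith
    · rw [inner_neg_left, real_inner_smul_left]
      have h2 : t₀ ≤ c⁻¹ * (s - inner ℝ v x₀) := by
        rw [le_inv_mul_iff₀ hc0]; linarith
      linarith

/-! ### Growth of coercive convex functions -/

theorem IsConvC.exists_coe_eq {ψ : E n → EReal} (hψ : IsConvC ψ) : ∃ x, ∃ c : ℝ, ψ x = c := by
  obtain ⟨x, hx⟩ := hψ.proper
  exact ⟨x, (ψ x).toReal, (EReal.coe_toReal hx.ne (hψ.ne_bot x)).symm⟩

/-- Coercive convex functions grow at least linearly. -/
theorem IsConvC.exists_linear_growth {ψ : E n → EReal} (hψ : IsConvC ψ) :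
    ∃ α > 0, ∃ β : ℝ, ∀ x, ((α * ‖x‖ - β : ℝ) : EReal) ≤ ψ x := by
  obtain ⟨x₀, c, hc⟩ := hψ.exists_coe_eq
  have hev : ∀ᶠ x in Bornology.cobounded (E n), ((c + 1 : ℝ) : EReal) < ψ x :=
    hψ.coercive.eventually (lt_mem_nhds (EReal.coe_lt_top _))
  obtain ⟨r, -, hr⟩ := (hasBasis_cobounded_norm (E := E n)).eventually_iff.1 hev
  -- The sphere of radius ρ about `x₀` then lies where ‖x‖ ≥ r, so ψ exceeds c + 1 on it.
  set ρ : ℝ := max r 0 + ‖x₀‖ + 1 with hρ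
  have hρ0 : 0 < ρ := by positivity
  obtain ⟨z, hz, hzmin⟩ := hψ.lsc.lowerSemicontinuousOn (Metric.closedBall x₀ ρ)
    |>.exists_isMinOn ⟨x₀, by simp [hρ0.le]⟩ (isCompact_closedBall x₀ ρ)
  obtain ⟨m, hm⟩ : ∃ m : ℝ, ψ z = m := by
    have h : ψ z ≤ c := hc ▸ hzmin (by simp [hρ0.le])
    exact ⟨(ψ z).toReal, (EReal.coe_toReal (ne_top_of_le_ne_top (EReal.coe_ne_top _) h)
      (hψ.ne_bot z)).symm⟩
  have main : ∀ x, ((ρ⁻¹ * ‖x - x₀‖ - max (-c) (1 - m) : ℝ) : EReal) ≤ ψ x := by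
    intro x
    by_cases hx : ‖x - x₀‖ ≤ ρ
    · have h1 : (m : EReal) ≤ ψ x := hm ▸ hzmin (by simpa [dist_eq_norm] using hx)
      refine le_trans (EReal.coe_le_coe_iff.2 ?_) h1
      have h2 : ρ⁻¹ * ‖x - x₀‖ ≤ 1 := by rw [inv_mul_le_iff₀ hρ0]; linarith
      linarith [le_max_right (-c) (1 - m)]
    · push Not at hx
      have hd : 0 < ‖x - x₀‖ := hρ0.trans hx
      -- At this parameter the segment from `x₀` to x crosses the sphere. There ψ has risen by more
      -- than 1, so convexity forces slope at least 1/ρ beyond.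
      set t := ρ / ‖x - x₀‖ with ht
      have ht0 : 0 < t := by positivity
      have ht1 : t < 1 := by rwa [ht, div_lt_one hd]
      have hconv := hψ.convex x₀ x (1 - t) t (by linarith) ht0 (by ring)
      have hnorm : r ≤ ‖(1 - t) • x₀ + t • x‖ := by
        have h1 : (1 - t) • x₀ + t • x = t • (x - x₀) - (-x₀) := by
          rw [smul_sub, sub_smul, one_smul]; abel
        have h2 : ‖t • (x - x₀)‖ = ρ := by
          rw [norm_smul, Real.norm_of_nonneg ht0.le, ht, div_mul_cancel₀ _ hd.ne']
        rw [h1]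
        have h3 := norm_sub_norm_le (t • (x - x₀)) (-x₀)
        rw [h2, norm_neg] at h3
        linarith [le_max_left r 0]
      have hlt := (hr hnorm).trans_le hconv
      rw [hc] at hlt
      induction hψx : ψ x with
      | bot => exact absurd hψx (hψ.ne_bot x)
      | top => exact le_top
      | coe s =>
        rw [hψx] at hlt
        norm_cast at hlt ⊢
        have h4 : 1 < t * (s - c) := by linarith
        have h5 : ρ⁻¹ * ‖x - x₀‖ < s - c := by
          rw [ht, div_mul_eq_mul_div, lt_div_iff₀ hd] at h4
          rw [inv_mul_lt_iff₀ hρ0]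
          linarith
        linarith [le_max_left (-c) (1 - m)]
  refine ⟨ρ⁻¹, by positivity, ρ⁻¹ * ‖x₀‖ + max (-c) (1 - m), fun x => le_trans ?_ (main x)⟩
  rw [EReal.coe_le_coe_iff]
  have h1 : ‖x‖ - ‖x₀‖ ≤ ‖x - x₀‖ := norm_sub_norm_le x x₀
  have h2 := mul_le_mul_of_nonneg_left h1 (inv_pos.2 hρ0).le
  linarith

theorem IsConvC.conj_conj {φ : E n → EReal} (hφ : IsConvC φ) : conj (conj φ) = φ := by
  obtain ⟨α, hα, β, h⟩ := hφ.exists_linear_growth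
  refine FunctionalUrysohn.conj_conj hφ.convex hφ.lsc hφ.proper ⟨0, β, fun x => le_trans ?_ (h x)⟩
  rw [EReal.coe_le_coe_iff, inner_zero_left]
  have := mul_nonneg hα.le (norm_nonneg x)
  linarith

/-! ### Integrability of log-concave functions -/

/-- One term of the exponential series gives domination by a multiple of (1 + ‖x‖)^{-(n+1)},
integrable because n + 1 exceeds the dimension. -/
theorem integrable_exp_neg_mul_norm (n : ℕ) {α : ℝ} (hα : 0 < α) :
    Integrable fun x : E n => Real.exp (-(α * ‖x‖)) := by
  have h := (integrable_one_add_norm (E := E n) (μ := volume) (r := ((n + 1 : ℕ) : ℝ))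
    (by simp)).const_mul ((n + 1).factorial * Real.exp α / α ^ (n + 1))
  refine h.mono' (by fun_prop) (ae_of_all _ fun x => ?_)
  have h1 : 0 < 1 + ‖x‖ := by positivity
  rw [Real.norm_of_nonneg (Real.exp_pos _).le, Real.rpow_neg h1.le, Real.rpow_natCast]
  have h2 := Real.pow_div_factorial_le_exp (α * (1 + ‖x‖)) (by positivity) (n + 1)
  rw [mul_add, mul_one, Real.exp_add, div_le_iff₀ (by positivity), ← mul_one_add, mul_pow] at h2
  rw [Real.exp_neg, ← div_eq_mul_inv, div_div, le_div_iff₀ (by positivity),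
    inv_mul_le_iff₀ (Real.exp_pos _)]
  linarith

theorem lintegral_exp_neg_lt_top {φ : E n → EReal} {α β : ℝ} (hα : 0 < α)
    (h : ∀ x, ((α * ‖x‖ - β : ℝ) : EReal) ≤ φ x) : ∫⁻ x, EReal.exp (-φ x) < ⊤ := by
  refine lt_of_le_of_lt (lintegral_mono fun x => ?_)
    ((integrable_exp_neg_mul_norm n hα).const_mul (Real.exp β)).lintegral_lt_top
  refine (EReal.exp_monotone (EReal.neg_le_neg_iff.2 (h x))).trans_eq ?_
  rw [← EReal.coe_neg, EReal.exp_coe, ← Real.exp_add]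
  congr 2
  ring

theorem measurable_exp_neg {φ : E n → EReal} (hφ : Measurable φ) :
    Measurable fun x => EReal.exp (-φ x) :=
  EReal.measurable_exp.comp hφ.neg

theorem IsConvC.lintegral_exp_neg_lt_top {φ : E n → EReal} (hφ : IsConvC φ) :
    ∫⁻ x, EReal.exp (-φ x) < ⊤ := by
  obtain ⟨α, hα, β, h⟩ := hφ.exists_linear_growth
  exact FunctionalUrysohn.lintegral_exp_neg_lt_top hα h

theorem IsConvC.integrable_expNeg {φ : E n → EReal} (hφ : IsConvC φ) : Integrable (expNeg φ) :=
  integrable_toReal_of_lintegral_ne_top (measurable_exp_neg hφ.lsc.measurable).aemeasurable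
    hφ.lintegral_exp_neg_lt_top.ne

theorem IsConvC.exp_neg_lt_top {φ : E n → EReal} (hφ : IsConvC φ) (x : E n) :
    EReal.exp (-φ x) < ⊤ := by
  rw [EReal.exp_lt_top_iff, lt_top_iff_ne_top]
  simpa using hφ.ne_bot x

theorem IsConvC.totalMass_expNeg {φ : E n → EReal} (hφ : IsConvC φ) :
    totalMass (expNeg φ) = (∫⁻ x, EReal.exp (-φ x)).toReal :=
  integral_toReal (measurable_exp_neg hφ.lsc.measurable).aemeasurable
    (ae_of_all _ hφ.exp_neg_lt_top)

theorem IsConvC.totalMass_le {φ ψ : E n → EReal} (hφ : IsConvC φ) (hψ : IsConvC ψ)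
    (h : ∫⁻ x, EReal.exp (-ψ x) ≤ ∫⁻ x, EReal.exp (-φ x)) :
    totalMass (expNeg ψ) ≤ totalMass (expNeg φ) := by
  rw [hφ.totalMass_expNeg, hψ.totalMass_expNeg]
  exact ENNReal.toReal_mono hφ.lintegral_exp_neg_lt_top.ne h

/-- The exponent is determined by f, so `f_rot` does not depend on a choice of ψ. As ψ avoids `⊥`,
the exponential is finite and `toReal` loses nothing. -/
theorem IsConvC.eq_of_expNeg_eq {φ ψ : E n → EReal} (hφ : IsConvC φ) (hψ : IsConvC ψ)
    (h : expNeg φ = expNeg ψ) : φ = ψ := by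
  funext x
  have hx := (ENNReal.toReal_eq_toReal_iff' (hφ.exp_neg_lt_top x).ne
    (hψ.exp_neg_lt_top x).ne).1 (congrFun h x)
  exact neg_injective (EReal.exp_strictMono.injective hx)

/-! ### The mass of the conjugate of a finite function -/

theorem exp_neg_rpow_mul {a b : ℝ} (ha : 0 < a) (hb : 0 < b) {p q : EReal} (hp : p ≠ ⊥)
    (hq : q ≠ ⊥) : EReal.exp (-p) ^ a * EReal.exp (-q) ^ b
      = EReal.exp (-((a : EReal) * p + (b : EReal) * q)) := by
  have h1 := coe_mul_ne_bot ha hp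
  have h2 := coe_mul_ne_bot hb hq
  rw [EReal.neg_add (Or.inl h1) (Or.inr h2), sub_eq_add_neg, EReal.exp_add, ← EReal.exp_mul,
    ← EReal.exp_mul, EReal.neg_mul, EReal.neg_mul, mul_comm p, mul_comm q]

/-- The total mass of `e^{-w*}`, where `w*` is the conjugate of the real valued function `w`. -/
noncomputable def massConj (w : E n → ℝ) : ENNReal :=
  ∫⁻ x, EReal.exp (-conj (fun y => (w y : EReal)) x)

theorem massConj_mono {w w' : E n → ℝ} (h : w ≤ w') : massConj w ≤ massConj w' :=
  lintegral_mono fun x => EReal.exp_monotone (EReal.neg_le_neg_iff.2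
    (conj_anti (fun y => EReal.coe_le_coe_iff.2 (h y)) x))

theorem conj_coe_ne_bot (w : E n → ℝ) (x : E n) : conj (fun y => (w y : EReal)) x ≠ ⊥ := by
  have h := inner_sub_le_conj (fun y => (w y : EReal)) x 0
  rw [← EReal.coe_sub] at h
  exact ne_bot_of_le_ne_bot (EReal.coe_ne_bot _) h

theorem conj_combination_le {a b : ℝ} (ha : 0 < a) (hb : 0 < b) (w w' : E n → ℝ) (x y : E n) :
    conj (fun z => ((a • w + b • w') z : EReal)) (a • x + b • y) ≤
      (a : EReal) * conj (fun z => (w z : EReal)) x +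
        (b : EReal) * conj (fun z => (w' z : EReal)) y := by
  refine iSup_le fun z => ?_
  refine le_trans ?_ (add_le_add (coe_mul_le_coe_mul ha (inner_sub_le_conj _ x z))
    (coe_mul_le_coe_mul hb (inner_sub_le_conj _ y z)))
  simp only [Pi.add_apply, Pi.smul_apply, smul_eq_mul, inner_add_left, real_inner_smul_left]
  norm_cast
  linarith

/-- Superlevel sets of `massConj` are convex. -/
theorem convex_setOf_le_massConj (c : ENNReal) : Convex ℝ {w : E n → ℝ | c ≤ massConj w} := by
  refine convex_iff_forall_pos.2 fun w hw w' hw' a b ha hb hab => ?_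
  -- This is log-concavity of `massConj`; the geometric mean of two values at least c is at least c.
  have h := prekopaLeindler_euclidean n a b ha hb hab _ _ _
    (measurable_exp_neg (measurable_conj fun z => (w z : EReal)))
    (measurable_exp_neg (measurable_conj fun z => (w' z : EReal)))
    (measurable_exp_neg (measurable_conj fun z => ((a • w + b • w') z : EReal))) fun x y => by
      rw [exp_neg_rpow_mul ha hb (conj_coe_ne_bot w x) (conj_coe_ne_bot w' y)]
      exact EReal.exp_monotone (EReal.neg_le_neg_iff.2 (conj_combination_le ha hb w w' x y))
  refine le_trans ?_ h
  calc c = c ^ a * c ^ b := by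
        rw [← ENNReal.rpow_add_of_nonneg _ _ ha.le hb.le, hab, ENNReal.rpow_one]
    _ ≤ _ := mul_le_mul' (ENNReal.rpow_le_rpow hw ha.le) (ENNReal.rpow_le_rpow hw' hb.le)

theorem conj_comp_linearIsometryEquiv (w : E n → EReal) (L : E n ≃ₗᵢ[ℝ] E n) (x : E n) :
    conj (fun y => w (L y)) x = conj w (L x) := by
  unfold conj
  refine L.toEquiv.iSup_congr fun y => ?_
  change ((inner ℝ (L x) (L y) : ℝ) : EReal) - w (L y) = _
  rw [L.inner_map_map]

theorem massConj_comp_linearIsometryEquiv (w : E n → ℝ) (L : E n ≃ₗᵢ[ℝ] E n) :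
    massConj (fun x => w (L x)) = massConj w := by
  unfold massConj
  rw [← L.measurePreserving.lintegral_comp
    (measurable_exp_neg (measurable_conj fun y => (w y : EReal)))]
  refine lintegral_congr fun x => ?_
  rw [← conj_comp_linearIsometryEquiv (fun y => (w y : EReal)) L x]

theorem massConj_lt_top {w : E n → ℝ} (hw : Continuous w) : massConj w < ⊤ := by
  obtain ⟨M, hM⟩ := (isCompact_closedBall (0 : E n) 1).bddAbove_image hw.continuousOn
  refine lintegral_exp_neg_lt_top one_pos (β := M) fun x => ?_
  refine le_trans ?_ (inner_sub_le_conj _ x (‖x‖⁻¹ • x))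
  rw [← EReal.coe_sub, EReal.coe_le_coe_iff]
  have h1 : ‖(‖x‖⁻¹ • x)‖ ≤ 1 := by
    rw [norm_smul, norm_inv, norm_norm]
    exact inv_mul_le_one
  have h2 : w (‖x‖⁻¹ • x) ≤ M := hM ⟨_, by simpa using h1, rfl⟩
  have h3 : inner ℝ x (‖x‖⁻¹ • x) = ‖x‖ := by
    rw [real_inner_smul_right, real_inner_self_eq_norm_sq]
    by_cases hx : ‖x‖ = 0
    · simp [hx]
    · field_simp
  rw [h3, one_mul]
  linarith

/-- As δ decreases to 0 the penalized conjugates increase to w*, so the integrands decrease;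
monotone convergence applies because the first mass is finite. -/
theorem le_massConj_of_forall_add {w : E n → ℝ} (hw : Continuous w) {c : ENNReal}
    (h : ∀ δ > 0, c ≤ massConj fun x => w x + δ * (1 + ‖x‖)) : c ≤ massConj w := by
  set δ : ℕ → ℝ := fun k => 1 / (k + 1) with hδ
  have hδ0 : ∀ k, 0 < δ k := fun k => by positivity
  have hδa : Antitone δ := fun k l hkl => one_div_le_one_div_of_le (by positivity)
    (by have : (k : ℝ) ≤ l := by exact_mod_cast hkl
        linarith)
  have hlim : Tendsto δ atTop (𝓝 0) := tendsto_one_div_add_atTop_nhds_zero_nat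
  set p : ℕ → E n → EReal := fun k => conj fun y => ((w y + δ k * (1 + ‖y‖) : ℝ) : EReal) with hp
  have hpm : ∀ x, Monotone fun k => p k x := fun x k l hkl =>
    conj_anti (fun y => EReal.coe_le_coe_iff.2 (add_le_add le_rfl
      (mul_le_mul_of_nonneg_right (hδa hkl) (by positivity)))) x
  have hcle : c ≤ ∫⁻ x, ⨅ k, EReal.exp (-p k x) := by
    rw [lintegral_iInf (fun k => measurable_exp_neg (measurable_conj _))
      (fun k l hkl x => EReal.exp_monotone (EReal.neg_le_neg_iff.2 (hpm x hkl)))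
      (massConj_lt_top (by fun_prop)).ne]
    exact le_iInf fun k => h (δ k) (hδ0 k)
  refine hcle.trans (lintegral_mono fun x => ?_)
  have h1 : Tendsto (fun k => EReal.exp (-p k x)) atTop (𝓝 (EReal.exp (-⨆ k, p k x))) :=
    (ENNReal.continuous_exp.tendsto _).comp
      ((continuous_neg.tendsto _).comp (tendsto_atTop_iSup (hpm x)))
  refine (ge_of_tendsto' h1 fun k => iInf_le _ k).trans
    (EReal.exp_monotone (EReal.neg_le_neg_iff.2 (iSup_le fun y => ?_)))
  have h2 : Tendsto (fun k => ((inner ℝ x y - (w y + δ k * (1 + ‖y‖)) : ℝ) : EReal)) atTop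
      (𝓝 ((inner ℝ x y - (w y + 0 * (1 + ‖y‖)) : ℝ) : EReal)) :=
    EReal.tendsto_coe.2 (((hlim.mul_const _).const_add _).const_sub _)
  rw [zero_mul, add_zero, EReal.coe_sub] at h2
  refine le_of_tendsto' h2 fun k => le_trans ?_ (le_iSup _ k)
  rw [EReal.coe_sub]
  exact inner_sub_le_conj (fun y => ((w y + δ k * (1 + ‖y‖) : ℝ) : EReal)) x y

/-! ### Rotations -/

theorem inner_rotate_rotate (θ : SO n) (x y : E n) :
    inner ℝ (rotate θ x) (rotate θ y) = inner ℝ x y := by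
  have hθ : (θ : Matrix (Fin n) (Fin n) ℝ).transpose * (θ : Matrix (Fin n) (Fin n) ℝ) = 1 :=
    Matrix.mem_orthogonalGroup_iff' _ _ |>.1 (Matrix.mem_specialOrthogonalGroup_iff.1 θ.2).1
  simp only [EuclideanSpace.inner_eq_star_dotProduct, rotate, Matrix.ofLp_toLpLin, Matrix.toLin'_apply,
    star_trivial]
  rw [Matrix.dotProduct_mulVec, Matrix.vecMul_mulVec, ← Matrix.dotProduct_mulVec]
  simp [hθ]

/-- The rotation by `θ` as a linear isometry. -/
noncomputable def rotateEquiv (θ : SO n) : E n ≃ₗᵢ[ℝ] E n :=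
  ((Matrix.toEuclideanLin (θ : Matrix (Fin n) (Fin n) ℝ)).isometryOfInner
    (inner_rotate_rotate θ)).toLinearIsometryEquiv rfl

theorem rotateEquiv_apply (θ : SO n) (x : E n) : rotateEquiv θ x = rotate θ x := rfl

theorem norm_rotate (θ : SO n) (x : E n) : ‖rotate θ x‖ = ‖x‖ := (rotateEquiv θ).norm_map x

/-- The rotation by `θ` as a continuous linear map. -/
noncomputable def rotateCLM (θ : SO n) : E n →L[ℝ] E n :=
  LinearMap.toContinuousLinearMap (Matrix.toEuclideanLin (θ : Matrix (Fin n) (Fin n) ℝ))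

theorem rotateCLM_apply (θ : SO n) (x : E n) : rotateCLM θ x = rotate θ x := rfl

theorem continuous_rotateCLM : Continuous (rotateCLM : SO n → E n →L[ℝ] E n) := by
  have h : Continuous ((LinearMap.toContinuousLinearMap :
      (E n →ₗ[ℝ] E n) ≃ₗ[ℝ] E n →L[ℝ] E n).toLinearMap ∘ₗ
      (Matrix.toEuclideanLin : Matrix (Fin n) (Fin n) ℝ ≃ₗ[ℝ] E n →ₗ[ℝ] E n).toLinearMap) :=
    LinearMap.continuous_of_finiteDimensional _
  exact h.comp continuous_subtype_val

theorem continuous_rotate_inv (x : E n) : Continuous fun θ : SO n => rotate θ⁻¹ x :=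
  (continuous_rotateCLM.comp continuous_inv).clm_apply continuous_const

/-! ### Averages of Lipschitz functions over rotations -/

variable {K : NNReal} {u : E n → ℝ}

/-- The function `u ∘ θ⁻¹`, divided by `1 + ‖x‖`. -/
noncomputable def weightedRotation (hu : LipschitzWith K u) (θ : SO n) :
    BoundedContinuousFunction (E n) ℝ :=
  BoundedContinuousFunction.ofNormedAddCommGroup (fun x => u (rotate θ⁻¹ x) / (1 + ‖x‖))
    ((hu.continuous.comp (rotateEquiv θ⁻¹).continuous).div (by fun_prop) fun x => by positivity)
    (|u 0| + K) fun x => by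
      have h1 : 0 < 1 + ‖x‖ := by positivity
      rw [norm_div, Real.norm_of_nonneg h1.le, div_le_iff₀ h1, Real.norm_eq_abs]
      have h2 := hu.dist_le_mul (rotate θ⁻¹ x) 0
      rw [Real.dist_eq, dist_zero_right, norm_rotate] at h2
      have h3 := abs_sub_abs_le_abs_sub (u (rotate θ⁻¹ x)) (u 0)
      nlinarith [abs_nonneg (u 0), norm_nonneg x, K.2]

theorem weightedRotation_apply (hu : LipschitzWith K u) (θ : SO n) (x : E n) :
    weightedRotation hu θ x = u (rotate θ⁻¹ x) / (1 + ‖x‖) := rfl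

/-- The difference of two rotated copies is at most K‖θ⁻¹ - θ₀⁻¹‖‖x‖, and the weight absorbs ‖x‖, so
continuity holds in the sup norm. -/
theorem continuous_weightedRotation (hu : LipschitzWith K u) :
    Continuous (weightedRotation hu) := by
  refine continuous_iff_continuousAt.2 fun θ₀ => tendsto_iff_dist_tendsto_zero.2 ?_
  have hlim : Tendsto (fun θ : SO n => (K : ℝ) * ‖rotateCLM θ⁻¹ - rotateCLM θ₀⁻¹‖) (𝓝 θ₀)
      (𝓝 0) := by
    have hc : Continuous fun θ : SO n => (K : ℝ) * ‖rotateCLM θ⁻¹ - rotateCLM θ₀⁻¹‖ :=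
      continuous_const.mul ((continuous_rotateCLM.comp continuous_inv).sub continuous_const).norm
    simpa using hc.tendsto θ₀
  refine squeeze_zero (fun _ => dist_nonneg) (fun θ => ?_) hlim
  refine (BoundedContinuousFunction.dist_le (by positivity)).2 fun x => ?_
  have h1 : 0 < 1 + ‖x‖ := by positivity
  rw [weightedRotation_apply, weightedRotation_apply, Real.dist_eq, ← sub_div, abs_div,
    abs_of_pos h1, div_le_iff₀ h1, ← Real.dist_eq]
  refine (hu.dist_le_mul _ _).trans ?_
  rw [mul_assoc]
  refine mul_le_mul_of_nonneg_left ?_ K.2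
  rw [dist_eq_norm, ← rotateCLM_apply, ← rotateCLM_apply, ← sub_apply]
  refine (ContinuousLinearMap.le_opNorm _ _).trans ?_
  exact mul_le_mul_of_nonneg_left (by linarith) (norm_nonneg _)

theorem integrable_weightedRotation (hu : LipschitzWith K u) (μ : Measure (SO n))
    [IsFiniteMeasure μ] : Integrable (weightedRotation hu) μ :=
  (continuous_weightedRotation hu).integrable_of_hasCompactSupport
    (HasCompactSupport.of_compactSpace _)

theorem integral_weightedRotation_apply (hu : LipschitzWith K u) (μ : Measure (SO n))
    [IsFiniteMeasure μ] (x : E n) :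
    (∫ θ, weightedRotation hu θ ∂μ) x = (∫ θ, u (rotate θ⁻¹ x) ∂μ) / (1 + ‖x‖) := by
  have h := (BoundedContinuousFunction.evalCLM ℝ x).integral_comp_comm
    (integrable_weightedRotation hu μ)
  simp only [BoundedContinuousFunction.evalCLM_apply, weightedRotation_apply] at h
  rw [← h, integral_div]

/-- Averaging a Lipschitz function over rotations increases the mass of `e^{-u*}`. -/
theorem massConj_le_massConj_average (hu : LipschitzWith K u) (μ : Measure (SO n))
    [IsProbabilityMeasure μ] :
    massConj u ≤ massConj fun x => ∫ θ, u (rotate θ⁻¹ x) ∂μ := by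
  set G := ∫ θ, weightedRotation hu θ ∂μ with hG
  have hGapp : ∀ x, ∫ θ, u (rotate θ⁻¹ x) ∂μ = G x * (1 + ‖x‖) := fun x => by
    rw [hG, integral_weightedRotation_apply, div_mul_cancel₀ _ (by positivity)]
  let S : Set (BoundedContinuousFunction (E n) ℝ) :=
    {g | massConj u ≤ massConj fun x => g x * (1 + ‖x‖)}
  have hS : Convex ℝ S := by
    intro g hg g' hg' a b ha hb hab
    have h := convex_setOf_le_massConj (massConj u) hg hg' ha hb hab
    refine le_trans h (le_of_eq (congrArg massConj ?_))
    funext x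
    simp only [Pi.add_apply, Pi.smul_apply, smul_eq_mul, BoundedContinuousFunction.coe_add,
      BoundedContinuousFunction.coe_smul]
    ring
  have hrange : ∀ θ, weightedRotation hu θ ∈ S := fun θ => by
    refine le_of_eq ((massConj_comp_linearIsometryEquiv u (rotateEquiv θ⁻¹)).symm.trans
      (congrArg massConj (funext fun x => ?_)))
    rw [weightedRotation_apply, div_mul_cancel₀ _ (by positivity), rotateEquiv_apply]
  -- `S` is not known to be closed, so the mean is placed only in its closure; an element of `S`
  -- within δ of it is then dominated by the penalized mean.
  have hmem : G ∈ closure S := hS.closure.integral_mem isClosed_closure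
    (ae_of_all _ fun θ => subset_closure (hrange θ)) (integrable_weightedRotation hu μ)
  simp only [hGapp]
  refine le_massConj_of_forall_add (by fun_prop) fun δ hδ => ?_
  obtain ⟨g, hgS, hg⟩ := Metric.mem_closure_iff.1 hmem δ hδ
  refine le_trans hgS (massConj_mono fun x => ?_)
  have h1 := (BoundedContinuousFunction.dist_coe_le_dist x).trans hg.le
  rw [Real.dist_eq] at h1
  have h2 := neg_le_of_abs_le h1
  have h3 : (g x - G x) * (1 + ‖x‖) ≤ δ * (1 + ‖x‖) :=
    mul_le_mul_of_nonneg_right (by linarith) (by positivity)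
  change g x * (1 + ‖x‖) ≤ G x * (1 + ‖x‖) + δ * (1 + ‖x‖)
  linarith

/-! ### Truncations -/

/-- The restriction of `ψ` to the ball of radius `R`, extended by `⊤`. -/
noncomputable def trunc (R : ℝ) (ψ : E n → EReal) (x : E n) : EReal :=
  if ‖x‖ ≤ R then ψ x else ⊤

theorem trunc_of_norm_le {R : ℝ} {x : E n} (ψ : E n → EReal) (h : ‖x‖ ≤ R) : trunc R ψ x = ψ x :=
  if_pos h

theorem le_trunc (R : ℝ) (ψ : E n → EReal) : ψ ≤ trunc R ψ := fun x => by
  unfold trunc; split_ifs <;> simp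

theorem trunc_anti {R S : ℝ} (h : R ≤ S) (ψ : E n → EReal) : trunc S ψ ≤ trunc R ψ := fun x => by
  unfold trunc
  split_ifs with h1 h2
  · exact le_rfl
  · exact le_top
  · linarith
  · exact le_rfl

theorem measurable_trunc (R : ℝ) {ψ : E n → EReal} (hψ : Measurable ψ) :
    Measurable (trunc R ψ) :=
  Measurable.ite (measurableSet_le measurable_norm measurable_const) hψ measurable_const

/-- Only slopes y with ‖y‖ ≤ R contribute to the supremum, which makes the conjugate R-Lipschitz. -/
theorem conj_trunc_le_add (R : ℝ) (ψ : E n → EReal) (x x' : E n) :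
    conj (trunc R ψ) x ≤ conj (trunc R ψ) x' + ((R * ‖x - x'‖ : ℝ) : EReal) := by
  refine iSup_le fun y => ?_
  by_cases hy : ‖y‖ ≤ R
  · refine le_trans ?_ (add_le_add_left (inner_sub_le_conj (trunc R ψ) x' y) _)
    have h : inner ℝ x y ≤ inner ℝ x' y + R * ‖x - x'‖ := by
      have h1 := real_inner_le_norm (x - x') y
      rw [inner_sub_left] at h1
      have h2 := mul_le_mul_of_nonneg_left hy (norm_nonneg (x - x'))
      linarith
    induction trunc R ψ y with
    | bot => rw [EReal.sub_bot (EReal.coe_ne_bot (inner ℝ x' y)), EReal.top_add_coe]; exact le_top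
    | top => simp
    | coe c => norm_cast; linarith
  · simp [trunc, hy]

theorem lintegral_exp_neg_trunc_tendsto {ψ : E n → EReal} (hψ : Measurable ψ) {R : ℕ → ℝ}
    (hR : Monotone R) (hR' : Tendsto R atTop atTop) :
    Tendsto (fun k => ∫⁻ x, EReal.exp (-trunc (R k) ψ x)) atTop
      (𝓝 (∫⁻ x, EReal.exp (-ψ x))) := by
  refine lintegral_tendsto_of_tendsto_of_monotone
    (fun k => (measurable_exp_neg (measurable_trunc _ hψ)).aemeasurable)
    (ae_of_all _ fun x k l hkl => EReal.exp_monotone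
      (EReal.neg_le_neg_iff.2 (trunc_anti (hR hkl) ψ x)))
    (ae_of_all _ fun x => tendsto_nhds_of_eventually_eq ?_)
  filter_upwards [hR'.eventually_ge_atTop ‖x‖] with k hk
  rw [trunc_of_norm_le ψ hk]

/-- The conjugate of a coercive convex function is the supremum of an increasing sequence of
finite convex Lipschitz functions. -/
theorem IsConvC.exists_approx {ψ : E n → EReal} (hψ : IsConvC ψ) :
    ∃ (u : ℕ → E n → ℝ) (K : ℕ → NNReal), (∀ k, LipschitzWith (K k) (u k)) ∧
      (∀ x, Monotone fun k => u k x) ∧ (∀ x, conj ψ x = ⨆ k, (u k x : EReal)) ∧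
      (∀ k x y, ∀ a b : ℝ, 0 < a → 0 < b → a + b = 1 →
        u k (a • x + b • y) ≤ a * u k x + b * u k y) ∧
      (∃ (v : E n) (c : ℝ), ∀ k x, inner ℝ x v - c ≤ u k x) ∧
      (∃ α > 0, ∃ β : ℝ, ∀ k x, ‖x‖ ≤ α → u k x ≤ β) ∧
      ∫⁻ x, EReal.exp (-ψ x) ≤ ⨆ k, massConj (u k) := by
  obtain ⟨x₀, c, hc⟩ := hψ.exists_coe_eq
  obtain ⟨α, hα, β, hβ⟩ := hψ.exists_linear_growth
  -- The shift keeps `x₀` in every ball, so all truncations are proper and their conjugates share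
  -- one affine minorant.
  let R : ℕ → ℝ := fun k => k + ‖x₀‖
  have hR0 : ∀ k, 0 ≤ R k := fun k => by positivity
  have hRmono : Monotone R := fun k l hkl => by
    have : (k : ℝ) ≤ l := by exact_mod_cast hkl
    change (k : ℝ) + ‖x₀‖ ≤ l + ‖x₀‖
    linarith
  have hRtop : Tendsto R atTop atTop :=
    tendsto_atTop_add_const_right _ _ tendsto_natCast_atTop_atTop
  have hlow : ∀ k x, ((inner ℝ x x₀ - c : ℝ) : EReal) ≤ conj (trunc (R k) ψ) x := fun k x => by
    have h := inner_sub_le_conj (trunc (R k) ψ) x x₀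
    rwa [trunc_of_norm_le ψ (by simp [R]), hc, ← EReal.coe_sub] at h
  have hup : ∀ k x, conj (trunc (R k) ψ) x ≤ ((R k * ‖x‖ + β : ℝ) : EReal) := fun k x => by
    refine conj_le_coe_iff.2 fun y => ?_
    by_cases hy : ‖y‖ ≤ R k
    · rw [trunc_of_norm_le ψ hy]
      refine le_trans (EReal.coe_le_coe_iff.2 ?_) (hβ y)
      have h1 := real_inner_le_norm x y
      have h2 := mul_le_mul_of_nonneg_left hy (norm_nonneg x)
      have h3 := mul_nonneg hα.le (norm_nonneg y)
      linarith
    · simp [trunc, hy]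
  let u : ℕ → E n → ℝ := fun k x => (conj (trunc (R k) ψ) x).toReal
  have hu : ∀ k x, (u k x : EReal) = conj (trunc (R k) ψ) x := fun k x =>
    EReal.coe_toReal (ne_top_of_le_ne_top (EReal.coe_ne_top _) (hup k x))
      (ne_bot_of_le_ne_bot (EReal.coe_ne_bot _) (hlow k x))
  have hule : ∀ k x, conj (trunc (R k) ψ) x ≤ conj ψ x := fun k x => conj_anti (le_trunc _ ψ) x
  refine ⟨u, fun k => ⟨R k, hR0 k⟩, fun k => ?_, fun x k l hkl => ?_, fun x => ?_, ?_,
    ⟨x₀, c, fun k x => ?_⟩, ⟨α, hα, β, fun k x hx => ?_⟩, ?_⟩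
  · refine LipschitzWith.of_le_add_mul _ fun x y => ?_
    have h := conj_trunc_le_add (R k) ψ x y
    rw [← hu, ← hu, ← EReal.coe_add, EReal.coe_le_coe_iff] at h
    rwa [dist_eq_norm]
  · rw [← EReal.coe_le_coe_iff, hu, hu]
    exact conj_anti (trunc_anti (hRmono hkl) ψ) x
  · simp only [hu]
    refine le_antisymm (iSup_le fun y => ?_) (iSup_le fun k => hule k x)
    obtain ⟨k, hk⟩ := (hRtop.eventually_ge_atTop ‖y‖).exists
    refine le_trans ?_ (le_iSup _ k)
    rw [← trunc_of_norm_le ψ hk]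
    exact inner_sub_le_conj _ x y
  · intro k x y a b ha hb hab
    have h := conj_convex (trunc (R k) ψ) x y a b ha hb hab
    rw [← hu, ← hu, ← hu] at h
    exact_mod_cast h
  · rw [← EReal.coe_le_coe_iff, hu]
    exact hlow k x
  · rw [← EReal.coe_le_coe_iff, hu]
    refine (hule k x).trans (conj_le_coe_iff.2 fun y => le_trans (EReal.coe_le_coe_iff.2 ?_) (hβ y))
    have h1 := real_inner_le_norm x y
    have h2 := mul_le_mul_of_nonneg_right hx (norm_nonneg y)
    linarith
  · refine le_of_tendsto' (lintegral_exp_neg_trunc_tendsto hψ.lsc.measurable hRmono hRtop)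
      fun k => le_trans ?_ (le_iSup _ k)
    refine lintegral_mono fun x => EReal.exp_monotone (EReal.neg_le_neg_iff.2 ?_)
    simp only [hu]
    exact conj_conj_le _ x

/-! ### Rotational averages -/

theorem integralE_coe {Ω : Type*} [MeasurableSpace Ω] {μ : Measure Ω} {g : Ω → ℝ}
    (hg : Integrable g μ) :
    ((∫⁻ ω, ENNReal.ofReal (g ω) ∂μ : ENNReal) : EReal) -
      ((∫⁻ ω, ENNReal.ofReal (-g ω) ∂μ : ENNReal) : EReal) = ((∫ ω, g ω ∂μ : ℝ) : EReal) := by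
  rw [integral_eq_lintegral_pos_part_sub_lintegral_neg_part hg, EReal.coe_sub,
    EReal.coe_ennreal_toReal, EReal.coe_ennreal_toReal]
  · exact hg.neg.lintegral_lt_top.ne
  · exact hg.lintegral_lt_top.ne

/-- Positive parts increase and negative parts decrease from an integrable one, so both integrals
converge. The negative limit is finite, which rules out ∞ - ∞. -/
theorem integralE_iSup {Ω : Type*} [MeasurableSpace Ω] {μ : Measure Ω} {g : ℕ → Ω → ℝ}
    (hg : ∀ k, Integrable (g k) μ) (hmono : ∀ ω, Monotone fun k => g k ω) :
    integralE μ (fun ω => ⨆ k, (g k ω : EReal)) = ⨆ k, ((∫ ω, g k ω ∂μ : ℝ) : EReal) := by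
  have hpt : ∀ ω, Tendsto (fun k => (g k ω : EReal)) atTop (𝓝 (⨆ k, (g k ω : EReal))) := fun ω =>
    tendsto_atTop_iSup fun k l hkl => EReal.coe_le_coe_iff.2 (hmono ω hkl)
  have hpos : Tendsto (fun k => ∫⁻ ω, ENNReal.ofReal (g k ω) ∂μ) atTop
      (𝓝 (∫⁻ ω, (⨆ k, (g k ω : EReal)).toENNReal ∂μ)) := by
    refine lintegral_tendsto_of_tendsto_of_monotone
      (fun k => (hg k).aestronglyMeasurable.aemeasurable.ennreal_ofReal)
      (ae_of_all _ fun ω k l hkl => ENNReal.ofReal_le_ofReal (hmono ω hkl))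
      (ae_of_all _ fun ω => ?_)
    simpa [Function.comp_def] using (EReal.continuous_toENNReal.tendsto _).comp (hpt ω)
  have hneg : Tendsto (fun k => ∫⁻ ω, ENNReal.ofReal (-g k ω) ∂μ) atTop
      (𝓝 (∫⁻ ω, (-⨆ k, (g k ω : EReal)).toENNReal ∂μ)) := by
    refine lintegral_tendsto_of_tendsto_of_antitone
      (fun k => (hg k).neg.aestronglyMeasurable.aemeasurable.ennreal_ofReal)
      (ae_of_all _ fun ω k l hkl => ENNReal.ofReal_le_ofReal (neg_le_neg (hmono ω hkl)))
      (hg 0).neg.lintegral_lt_top.ne (ae_of_all _ fun ω => ?_)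
    have h := (EReal.continuous_toENNReal.tendsto _).comp ((continuous_neg.tendsto _).comp (hpt ω))
    simpa [Function.comp_def, ← EReal.coe_neg] using h
  have hnegfin : ∫⁻ ω, (-⨆ k, (g k ω : EReal)).toENNReal ∂μ ≠ ⊤ := by
    refine ne_top_of_le_ne_top (hg 0).neg.lintegral_lt_top.ne (lintegral_mono fun ω => ?_)
    have h := EReal.toENNReal_le_toENNReal
      (EReal.neg_le_neg_iff.2 (le_iSup (fun k => (g k ω : EReal)) 0))
    simpa [← EReal.coe_neg] using h
  have h1 : Tendsto (fun k => ((∫ ω, g k ω ∂μ : ℝ) : EReal)) atTop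
      (𝓝 (integralE μ (fun ω => ⨆ k, (g k ω : EReal)))) := by
    simp only [← integralE_coe (hg _), integralE, sub_eq_add_neg]
    have hadd := EReal.continuousAt_add
      (p := (((∫⁻ ω, (⨆ k, (g k ω : EReal)).toENNReal ∂μ : ENNReal) : EReal),
        -((∫⁻ ω, (-⨆ k, (g k ω : EReal)).toENNReal ∂μ : ENNReal) : EReal)))
      (Or.inr (by simpa using hnegfin)) (Or.inl (EReal.coe_ennreal_ne_bot _))
    exact hadd.tendsto.comp
      (((continuous_coe_ennreal_ereal.tendsto _).comp hpos).prodMk_nhds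
        ((continuous_neg.tendsto _).comp ((continuous_coe_ennreal_ereal.tendsto _).comp hneg)))
  exact tendsto_nhds_unique h1 (tendsto_atTop_iSup fun k l hkl => EReal.coe_le_coe_iff.2
    (integral_mono (hg k) (hg l) fun ω => hmono ω hkl))

instance instIsProbabilityMeasureHaarSO (n : ℕ) : IsProbabilityMeasure (haarSO n) :=
  ⟨haarSO_univ n⟩

/-- The average of a real valued function over rotations. -/
noncomputable def rotMean (u : E n → ℝ) (x : E n) : ℝ := ∫ θ, u (rotate θ⁻¹ x) ∂haarSO n

theorem integrable_comp_rotate {u : E n → ℝ} (hu : Continuous u) (x : E n) :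
    Integrable (fun θ : SO n => u (rotate θ⁻¹ x)) (haarSO n) :=
  (hu.comp (continuous_rotate_inv x)).integrable_of_hasCompactSupport
    (HasCompactSupport.of_compactSpace _)

theorem rotMean_mono {u v : E n → ℝ} (hu : Continuous u) (hv : Continuous v) (h : u ≤ v) :
    rotMean u ≤ rotMean v := fun x =>
  integral_mono (integrable_comp_rotate hu x) (integrable_comp_rotate hv x) fun _ => h _

theorem rotMean_lipschitzWith {K : NNReal} {u : E n → ℝ} (hu : LipschitzWith K u) :
    LipschitzWith K (rotMean u) := by
  refine LipschitzWith.of_le_add_mul _ fun x y => ?_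
  have h := integral_mono (integrable_comp_rotate hu.continuous x)
    ((integrable_comp_rotate hu.continuous y).add (integrable_const (K * dist x y)))
    fun θ => (by
      have h1 := hu.le_add_mul (rotate θ⁻¹ x) (rotate θ⁻¹ y)
      have h2 : dist (rotate θ⁻¹ x) (rotate θ⁻¹ y) = dist x y := (rotateEquiv θ⁻¹).dist_map x y
      rwa [h2] at h1)
  simp only [Pi.add_apply] at h
  rwa [integral_add (integrable_comp_rotate hu.continuous y) (integrable_const _), integral_const,
    probReal_univ, one_smul] at h

theorem rotMean_convex {u : E n → ℝ} (hu : Continuous u)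
    (hconv : ∀ x y, ∀ a b : ℝ, 0 < a → 0 < b → a + b = 1 → u (a • x + b • y) ≤ a * u x + b * u y)
    (x y : E n) (a b : ℝ) (ha : 0 < a) (hb : 0 < b) (hab : a + b = 1) :
    rotMean u (a • x + b • y) ≤ a * rotMean u x + b * rotMean u y := by
  have hx := (integrable_comp_rotate hu x).const_mul a
  have hy := (integrable_comp_rotate hu y).const_mul b
  unfold rotMean
  rw [← integral_const_mul, ← integral_const_mul, ← integral_add hx hy]
  refine integral_mono (integrable_comp_rotate hu _) (hx.add hy) fun θ => ?_
  have h : rotate θ⁻¹ (a • x + b • y) = a • rotate θ⁻¹ x + b • rotate θ⁻¹ y := by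
    simp [rotate]
  simp only [h]
  exact hconv _ _ a b ha hb hab

theorem rotMean_inner_sub (v : E n) (c : ℝ) :
    ∃ v' : E n, ∀ x, rotMean (fun y => inner ℝ y v - c) x = inner ℝ v' x - c := by
  have hint : ∀ x, Integrable (fun θ : SO n => inner ℝ (rotate θ⁻¹ x) v) (haarSO n) := fun x =>
    integrable_comp_rotate (u := fun y => inner ℝ y v) (by fun_prop) x
  let L : E n →ₗ[ℝ] ℝ :=
    { toFun := fun x => ∫ θ, inner ℝ (rotate θ⁻¹ x) v ∂haarSO n
      map_add' := fun x y => by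
        rw [← integral_add (hint x) (hint y)]
        refine integral_congr_ae (ae_of_all _ fun θ => ?_)
        simp [rotate, inner_add_left]
      map_smul' := fun a x => by
        rw [RingHom.id_apply, smul_eq_mul, ← integral_const_mul]
        refine integral_congr_ae (ae_of_all _ fun θ => ?_)
        simp [rotate, real_inner_smul_left] }
  refine ⟨(InnerProductSpace.toDual ℝ (E n)).symm L.toContinuousLinearMap, fun x => ?_⟩
  rw [InnerProductSpace.toDual_symm_apply]
  change _ = (∫ θ, inner ℝ (rotate θ⁻¹ x) v ∂haarSO n) - c
  unfold rotMean
  rw [integral_sub (hint x) (integrable_const c), integral_const, probReal_univ, one_smul]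

/-! ### Existence of the rotational epi-symmetrization for `n ≥ 2` -/

theorem ne_bot_of_linear_growth {φ : E n → EReal} {α β : ℝ}
    (h : ∀ x, ((α * ‖x‖ - β : ℝ) : EReal) ≤ φ x) (x : E n) : φ x ≠ ⊥ :=
  ne_bot_of_le_ne_bot (EReal.coe_ne_bot _) (h x)

theorem coercive_of_linear_growth {φ : E n → EReal} {α β : ℝ} (hα : 0 < α)
    (h : ∀ x, ((α * ‖x‖ - β : ℝ) : EReal) ≤ φ x) :
    Tendsto φ (Bornology.cobounded (E n)) (𝓝 ⊤) := by
  refine tendsto_nhds_top_mono' (EReal.tendsto_coe_nhds_top_iff.2 ?_) h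
  exact tendsto_atTop_add_const_right _ _ (tendsto_norm_cobounded_atTop.const_mul_atTop hα)

/-- Testing the conjugate at αx/‖x‖, where `h` is at most β, gives growth of slope α; the affine
minorant makes the conjugate finite at `v`. -/
theorem isConvC_conj {h : E n → EReal} {v : E n} {c α β : ℝ}
    (hlow : ∀ x, ((inner ℝ v x - c : ℝ) : EReal) ≤ h x) (hα : 0 < α)
    (hup : ∀ x, ‖x‖ ≤ α → h x ≤ β) : IsConvC (conj h) := by
  have hgrowth : ∀ x, ((α * ‖x‖ - β : ℝ) : EReal) ≤ conj h x := fun x => by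
    refine le_trans ?_ (inner_sub_le_conj h x ((α * ‖x‖⁻¹) • x))
    have h1 : ‖(α * ‖x‖⁻¹) • x‖ ≤ α := by
      rw [norm_smul, Real.norm_of_nonneg (by positivity), mul_assoc]
      exact mul_le_of_le_one_right hα.le inv_mul_le_one
    have h2 : inner ℝ x ((α * ‖x‖⁻¹) • x) = α * ‖x‖ := by
      rw [real_inner_smul_right, real_inner_self_eq_norm_sq]
      by_cases hx : ‖x‖ = 0
      · simp [hx]
      · field_simp
    rw [h2, EReal.coe_sub]
    exact EReal.sub_le_sub le_rfl (hup _ h1)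
  exact
    { ne_bot := ne_bot_of_linear_growth hgrowth
      convex := conj_convex h
      coercive := coercive_of_linear_growth hα hgrowth
      proper := ⟨v, (conj_le_coe_iff.2 hlow).trans_lt (EReal.coe_lt_top c)⟩
      lsc := lowerSemicontinuous_conj h }

theorem rotAverage_conj_eq {ψ : E n → EReal} {u : ℕ → E n → ℝ} (hu : ∀ k, Continuous (u k))
    (hmono : ∀ x, Monotone fun k => u k x) (hsup : ∀ x, conj ψ x = ⨆ k, (u k x : EReal))
    (x : E n) : rotAverage (conj ψ) x = ⨆ k, (rotMean (u k) x : EReal) := by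
  unfold rotAverage
  simp only [hsup]
  exact integralE_iSup (fun k => integrable_comp_rotate (hu k) x) fun θ => hmono _

/-- The candidate for ψ_rot is the conjugate of the averaged conjugate. Fenchel-Moreau applies
because the average is a supremum of continuous convex means with an affine minorant, bounded above
near 0. -/
theorem IsConvC.conj_rotAverage {ψ : E n → EReal} (hψ : IsConvC ψ) :
    IsConvC (conj (rotAverage (conj ψ))) ∧
      conj (conj (rotAverage (conj ψ))) = rotAverage (conj ψ) := by
  obtain ⟨u, K, hlip, hmono, hsup, hconv, ⟨v, c, hlow⟩, ⟨α, hα, β, hup⟩, -⟩ := hψ.exists_approx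
  have hc : ∀ k, Continuous (u k) := fun k => (hlip k).continuous
  have heq := rotAverage_conj_eq hc hmono hsup
  obtain ⟨v', hv'⟩ := rotMean_inner_sub v c
  have hlow' : ∀ x, ((inner ℝ v' x - c : ℝ) : EReal) ≤ rotAverage (conj ψ) x := fun x => by
    rw [heq]
    refine le_trans (EReal.coe_le_coe_iff.2 ?_) (le_iSup (fun k => (rotMean (u k) x : EReal)) 0)
    rw [← hv']
    exact rotMean_mono (by fun_prop) (hc 0) (hlow 0) x
  have hup' : ∀ x, ‖x‖ ≤ α → rotAverage (conj ψ) x ≤ β := fun x hx => by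
    rw [heq]
    refine iSup_le fun k => EReal.coe_le_coe_iff.2 ?_
    have h := integral_mono (integrable_comp_rotate (hc k) x) (integrable_const β)
      fun θ => hup k (rotate θ⁻¹ x) (by rwa [norm_rotate])
    rwa [integral_const, probReal_univ, one_smul] at h
  refine ⟨isConvC_conj hlow' hα hup', FunctionalUrysohn.conj_conj ?_ ?_ ⟨0, ?_⟩ ⟨v', c, hlow'⟩⟩
  · intro x y a b ha hb hab
    rw [heq (a • x + b • y)]
    refine iSup_le fun k => ?_
    refine (EReal.coe_le_coe_iff.2 (rotMean_convex (hc k) (hconv k) x y a b ha hb hab)).trans ?_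
    rw [EReal.coe_add, EReal.coe_mul, EReal.coe_mul, heq, heq]
    exact add_le_add (coe_mul_le_coe_mul ha (le_iSup (fun k => (rotMean (u k) x : EReal)) k))
      (coe_mul_le_coe_mul hb (le_iSup (fun k => (rotMean (u k) y : EReal)) k))
  · rw [funext heq]
    exact lowerSemicontinuous_iSup fun k => (continuous_coe_real_ereal.comp
      (rotMean_lipschitzWith (hlip k)).continuous).lowerSemicontinuous
  · exact (hup' 0 (by simpa using hα.le)).trans_lt (EReal.coe_lt_top _)

/-- The integral inequality for the rotational epi-symmetrization defined by conjugates. -/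
theorem IsConvC.lintegral_exp_neg_le {ψ φ : E n → EReal} (hψ : IsConvC ψ) (hφ : IsConvC φ)
    (h : conj φ = rotAverage (conj ψ)) :
    ∫⁻ x, EReal.exp (-ψ x) ≤ ∫⁻ x, EReal.exp (-φ x) := by
  obtain ⟨u, K, hlip, hmono, hsup, -, -, -, hmass⟩ := hψ.exists_approx
  have heq := rotAverage_conj_eq (fun k => (hlip k).continuous) hmono hsup
  refine hmass.trans (iSup_le fun k =>
    (massConj_le_massConj_average (hlip k) (haarSO n)).trans (lintegral_mono fun x => ?_))
  refine EReal.exp_monotone (EReal.neg_le_neg_iff.2 ?_)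
  -- Writing φ as its biconjugate reduces the claim to `rotMean (u k)` lying below the average of
  -- ψ*.
  rw [← congrFun hφ.conj_conj x, h]
  refine conj_anti (fun y => ?_) x
  rw [heq]
  exact le_iSup (fun k => (rotMean (u k) y : EReal)) k

/-! ### The epi-mean of a function and its reflection -/

/-- The value `⊥` is excluded because `⊥ + ⊤ = ⊥` in `EReal`, which would break the bound. -/
theorem le_iInf_add_iInf {ι κ : Type*} {p : EReal} {f : ι → EReal} {g : κ → EReal}
    (hf : ⨅ i, f i ≠ ⊥) (hg : ⨅ j, g j ≠ ⊥) (h : ∀ i j, p ≤ f i + g j) :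
    p ≤ (⨅ i, f i) + ⨅ j, g j := by
  refine EReal.le_add_of_forall_gt (Or.inl hf) (Or.inr hg) fun a' ha' b' hb' => ?_
  obtain ⟨i, hi⟩ := iInf_lt_iff.1 ha'
  obtain ⟨j, hj⟩ := iInf_lt_iff.1 hb'
  exact (h i j).trans (add_le_add hi.le hj.le)

theorem coe_inv_mul_coe_mul {a : ℝ} (ha : 0 < a) (d : EReal) :
    ((a⁻¹ : ℝ) : EReal) * ((a : EReal) * d) = d := by
  rw [← mul_assoc, ← EReal.coe_mul, inv_mul_cancel₀ ha.ne', EReal.coe_one, one_mul]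

theorem coe_mul_le_iff {a : ℝ} (ha : 0 < a) {d e : EReal} :
    (a : EReal) * d ≤ e ↔ d ≤ ((a⁻¹ : ℝ) : EReal) * e := by
  refine ⟨fun h => ?_, fun h => ?_⟩
  · simpa only [coe_inv_mul_coe_mul ha] using coe_mul_le_coe_mul (inv_pos.2 ha) h
  · have h' := coe_inv_mul_coe_mul (inv_pos.2 ha) e
    rw [inv_inv] at h'
    exact (coe_mul_le_coe_mul ha h).trans_eq h'

theorem coe_mul_iInf {ι : Type*} {a : ℝ} (ha : 0 < a) (f : ι → EReal) :
    (a : EReal) * ⨅ i, f i = ⨅ i, (a : EReal) * f i := by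
  refine le_antisymm (le_iInf fun i => coe_mul_le_coe_mul ha (iInf_le _ i)) ?_
  have h := (coe_mul_le_iff (inv_pos.2 ha) (d := ⨅ i, (a : EReal) * f i) (e := ⨅ i, f i)).1
    (le_iInf fun i => by
      rw [← coe_inv_mul_coe_mul ha (f i)]
      exact coe_mul_le_coe_mul (inv_pos.2 ha) (iInf_le _ i))
  rwa [inv_inv] at h

theorem coe_mul_add {a : ℝ} (ha : 0 < a) (d e : EReal) :
    (a : EReal) * (d + e) = (a : EReal) * d + (a : EReal) * e :=
  EReal.left_distrib_of_nonneg_of_ne_top (EReal.coe_nonneg.2 ha.le) (EReal.coe_ne_top a) d e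

theorem infConv_convex {ψ χ : E n → EReal}
    (hψ : ∀ x y : E n, ∀ a b : ℝ, 0 < a → 0 < b → a + b = 1 →
      ψ (a • x + b • y) ≤ (a : EReal) * ψ x + (b : EReal) * ψ y)
    (hχ : ∀ x y : E n, ∀ a b : ℝ, 0 < a → 0 < b → a + b = 1 →
      χ (a • x + b • y) ≤ (a : EReal) * χ x + (b : EReal) * χ y)
    (hbot : ∀ x, infConv ψ χ x ≠ ⊥) (x y : E n) (a b : ℝ) (ha : 0 < a) (hb : 0 < b)
    (hab : a + b = 1) :
    infConv ψ χ (a • x + b • y) ≤ (a : EReal) * infConv ψ χ x + (b : EReal) * infConv ψ χ y := by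
  have hx := coe_mul_ne_bot ha (hbot x)
  have hy := coe_mul_ne_bot hb (hbot y)
  unfold infConv at hx hy ⊢
  rw [coe_mul_iInf ha, coe_mul_iInf hb] at *
  refine le_iInf_add_iInf hx hy fun z w => (iInf_le _ (a • z + b • w)).trans ?_
  have h1 : a • x + b • y - (a • z + b • w) = a • (x - z) + b • (y - w) := by
    rw [smul_sub, smul_sub]; abel
  rw [h1, coe_mul_add ha, coe_mul_add hb, add_add_add_comm]
  exact add_le_add (hψ _ _ a b ha hb hab) (hχ _ _ a b ha hb hab)

/-- Linear growth makes the sublevel sets of (x, y) ↦ ψ(x - y) + χ(y) compact at real levels. A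
sublevel set of the infimum is the intersection of their projections over all higher real levels, so
attainment is not needed. -/
theorem lowerSemicontinuous_infConv {ψ χ : E n → EReal} {α β : ℝ} (hα : 0 < α)
    (hψ : LowerSemicontinuous ψ) (hχ : LowerSemicontinuous χ)
    (hψg : ∀ x, ((α * ‖x‖ - β : ℝ) : EReal) ≤ ψ x)
    (hχg : ∀ x, ((α * ‖x‖ - β : ℝ) : EReal) ≤ χ x) : LowerSemicontinuous (infConv ψ χ) := by
  have hF : LowerSemicontinuous fun p : E n × E n => ψ (p.1 - p.2) + χ p.2 := by
    refine LowerSemicontinuous.add' (hψ.comp (continuous_fst.sub continuous_snd))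
      (hχ.comp continuous_snd) fun p => ?_
    exact EReal.continuousAt_add (Or.inr (ne_bot_of_linear_growth hχg _))
      (Or.inl (ne_bot_of_linear_growth hψg _))
  have hcompact : ∀ s : ℝ, IsCompact {p : E n × E n | ψ (p.1 - p.2) + χ p.2 ≤ s} := by
    intro s
    refine ((isCompact_closedBall (0 : E n) ((s + 2 * β) / α)).prod
      (isCompact_closedBall (0 : E n) ((s + 2 * β) / α))).of_isClosed_subset
      (hF.isClosed_preimage (s : EReal)) fun p hp => ?_
    have h1 := (add_le_add (hψg (p.1 - p.2)) (hχg p.2)).trans hp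
    rw [← EReal.coe_add, EReal.coe_le_coe_iff] at h1
    have h2 : ‖p.1‖ ≤ ‖p.1 - p.2‖ + ‖p.2‖ := by
      simpa using norm_add_le (p.1 - p.2) p.2
    have h3 := mul_le_mul_of_nonneg_left h2 hα.le
    have h4 := mul_nonneg hα.le (norm_nonneg (p.1 - p.2))
    constructor
    · rw [mem_closedBall_zero_iff, le_div_iff₀ hα]; linarith
    · rw [mem_closedBall_zero_iff, le_div_iff₀ hα]; linarith
  refine lowerSemicontinuous_iff_isClosed_preimage.2 fun t => ?_
  have hset : infConv ψ χ ⁻¹' Set.Iic t =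
      ⋂ (s : ℝ) (_ : t < s), Prod.fst '' {p : E n × E n | ψ (p.1 - p.2) + χ p.2 ≤ s} := by
    ext z
    simp only [Set.mem_preimage, Set.mem_Iic, Set.mem_iInter]
    refine ⟨fun hz s hs => ?_, fun hz => ?_⟩
    · obtain ⟨y, hy⟩ := iInf_lt_iff.1 (hz.trans_lt hs)
      exact ⟨(z, y), hy.le, rfl⟩
    · refine EReal.le_of_forall_lt_iff_le.1 fun s hs => ?_
      obtain ⟨⟨z', y⟩, hp, rfl⟩ := hz s hs
      exact (iInf_le _ y).trans hp
  rw [hset]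
  exact isClosed_biInter fun s _ => ((hcompact s).image continuous_fst).isClosed

theorem IsConvC.epiMul_infConv_neg {ψ : E n → EReal} (hψ : IsConvC ψ) :
    IsConvC (epiMul (1 / 2) (infConv ψ fun x => ψ (-x))) := by
  obtain ⟨α, hα, β, hg⟩ := hψ.exists_linear_growth
  have hg' : ∀ x, ((α * ‖x‖ - β : ℝ) : EReal) ≤ ψ (-x) := fun x => by
    simpa only [norm_neg] using hg (-x)
  have hhalf : (0 : ℝ) < 1 / 2 := by norm_num
  have hS : ∀ z, ((α * ‖z‖ - 2 * β : ℝ) : EReal) ≤ infConv ψ (fun x => ψ (-x)) z := fun z => by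
    refine le_iInf fun y => le_trans ?_ (add_le_add (hg (z - y)) (hg' y))
    rw [← EReal.coe_add, EReal.coe_le_coe_iff]
    have h2 : ‖z‖ ≤ ‖z - y‖ + ‖y‖ := by simpa using norm_add_le (z - y) y
    have h3 := mul_le_mul_of_nonneg_left h2 hα.le
    linarith
  have hgrowth : ∀ x, ((α * ‖x‖ - β : ℝ) : EReal) ≤
      epiMul (1 / 2) (infConv ψ fun x => ψ (-x)) x := fun x => by
    refine le_trans ?_ (coe_mul_le_coe_mul hhalf (hS _))
    rw [← EReal.coe_mul, EReal.coe_le_coe_iff, norm_smul]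
    norm_num
    linarith
  have hneg : ∀ x y : E n, ∀ a b : ℝ, 0 < a → 0 < b → a + b = 1 →
      ψ (-(a • x + b • y)) ≤ (a : EReal) * ψ (-x) + (b : EReal) * ψ (-y) := by
    intro x y a b ha hb hab
    rw [neg_add, ← smul_neg, ← smul_neg]
    exact hψ.convex _ _ a b ha hb hab
  refine
    { ne_bot := ne_bot_of_linear_growth hgrowth
      convex := fun x y a b ha hb hab => ?_
      coercive := coercive_of_linear_growth hα hgrowth
      proper := ?_
      lsc := ?_ }
  · unfold epiMul
    have h := infConv_convex hψ.convex hneg (ne_bot_of_linear_growth hS) ((1 / 2 : ℝ)⁻¹ • x)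
      ((1 / 2 : ℝ)⁻¹ • y) a b ha hb hab
    rw [smul_add, smul_comm _ a, smul_comm _ b]
    refine (coe_mul_le_coe_mul hhalf h).trans_eq ?_
    rw [coe_mul_add hhalf, mul_left_comm, mul_left_comm _ (b : EReal)]
  · obtain ⟨x₀, c, hc⟩ := hψ.exists_coe_eq
    refine ⟨0, ?_⟩
    have h : infConv ψ (fun x => ψ (-x)) ((1 / 2 : ℝ)⁻¹ • 0) ≤ ((c + c : ℝ) : EReal) := by
      refine (iInf_le _ (-x₀)).trans ?_
      simp [hc]
    refine (coe_mul_le_coe_mul hhalf h).trans_lt ?_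
    rw [← EReal.coe_mul]
    exact EReal.coe_lt_top _
  · have hlsc := lowerSemicontinuous_infConv hα hψ.lsc (hψ.lsc.comp continuous_neg) hg hg'
    refine lowerSemicontinuous_iff_isClosed_preimage.2 fun t => ?_
    have hset : epiMul (1 / 2) (infConv ψ fun x => ψ (-x)) ⁻¹' Set.Iic t =
        (fun x => (1 / 2 : ℝ)⁻¹ • x) ⁻¹' (infConv ψ (fun x => ψ (-x)) ⁻¹'
          Set.Iic (((1 / 2 : ℝ)⁻¹ : ℝ) * t)) := by
      ext x
      exact coe_mul_le_iff hhalf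
    rw [hset]
    exact (hlsc.isClosed_preimage _).preimage (by fun_prop)

/-- Prékopa-Leindler with weights 1/2 for e^{-ψ} and its reflection, which have equal mass. At (x +
y)/2 the rescaled infimal convolution is evaluated at x + y, where y is a competitor. -/
theorem IsConvC.lintegral_exp_neg_le_epiMul {ψ : E n → EReal} (hψ : IsConvC ψ) :
    ∫⁻ x, EReal.exp (-ψ x) ≤
      ∫⁻ x, EReal.exp (-epiMul (1 / 2) (infConv ψ fun x => ψ (-x)) x) := by
  have hhalf : (0 : ℝ) < 1 / 2 := by norm_num
  have hmeas := measurable_exp_neg hψ.lsc.measurable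
  have h := prekopaLeindler_euclidean n (1 / 2) (1 / 2) hhalf hhalf (by norm_num)
    (fun x => EReal.exp (-ψ x)) (fun x => EReal.exp (-ψ (-x)))
    (fun x => EReal.exp (-epiMul (1 / 2) (infConv ψ fun x => ψ (-x)) x)) hmeas
    (hmeas.comp measurable_neg) (measurable_exp_neg hψ.epiMul_infConv_neg.lsc.measurable)
    fun x y => by
      rw [exp_neg_rpow_mul hhalf hhalf (hψ.ne_bot x) (hψ.ne_bot (-y)), ← coe_mul_add hhalf]
      refine EReal.exp_monotone (EReal.neg_le_neg_iff.2 (coe_mul_le_coe_mul hhalf ?_))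
      refine (iInf_le _ y).trans_eq ?_
      rw [← smul_add, inv_smul_smul₀ hhalf.ne', add_sub_cancel_right]
  have hrefl : ∫⁻ x : E n, EReal.exp (-ψ (-x)) = ∫⁻ x, EReal.exp (-ψ x) :=
    (LinearIsometryEquiv.neg ℝ (E := E n)).measurePreserving.lintegral_comp hmeas
  rwa [hrefl, ← ENNReal.rpow_add_of_nonneg _ _ hhalf.le hhalf.le, add_halves,
    ENNReal.rpow_one] at h

/-! ### The functional Urysohn inequality -/

theorem IsConvC.exists_isRotEpiSymm {ψ : E n → EReal} (hn : 1 ≤ n) (hψ : IsConvC ψ) :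
    ∃ φ, IsRotEpiSymm ψ φ := by
  obtain ⟨h1, h2⟩ := hψ.conj_rotAverage
  rcases hn.eq_or_lt with hn | hn
  · exact ⟨_, hψ.epiMul_infConv_neg, fun h => by omega, fun _ => rfl⟩
  · exact ⟨_, h1, fun _ x => congrFun h2 x, fun h => by omega⟩

theorem IsRotEpiSymm.unique {ψ φ φ' : E n → EReal} (hn : 1 ≤ n) (h : IsRotEpiSymm ψ φ)
    (h' : IsRotEpiSymm ψ φ') : φ = φ' := by
  rcases hn.eq_or_lt with hn | hn
  · rw [h.eq_one_dim hn.symm, h'.eq_one_dim hn.symm]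
  · rw [← h.isConvC.conj_conj, ← h'.isConvC.conj_conj, funext (h.conj_eq hn),
      funext (h'.conj_eq hn)]

theorem IsRotEpiSymm.lintegral_exp_neg_le {ψ φ : E n → EReal} (hn : 1 ≤ n) (hψ : IsConvC ψ)
    (h : IsRotEpiSymm ψ φ) : ∫⁻ x, EReal.exp (-ψ x) ≤ ∫⁻ x, EReal.exp (-φ x) := by
  rcases hn.eq_or_lt with hn | hn
  · rw [h.eq_one_dim hn.symm]
    exact hψ.lintegral_exp_neg_le_epiMul
  · exact hψ.lintegral_exp_neg_le h.isConvC (funext (h.conj_eq hn))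

end FunctionalUrysohn

theorem mainTheorem5 (n : ℕ) (hn : 1 ≤ n) (f : EuclideanSpace ℝ (Fin n) → ℝ)
    (hf : f ∈ FunctionalUrysohn.LCc n) :
    (∃! g : EuclideanSpace ℝ (Fin n) → ℝ, FunctionalUrysohn.IsRotHypoSymm f g) ∧
    ∀ g : EuclideanSpace ℝ (Fin n) → ℝ, FunctionalUrysohn.IsRotHypoSymm f g →
      MeasureTheory.Integrable f ∧ MeasureTheory.Integrable g ∧
        FunctionalUrysohn.totalMass f ≤ FunctionalUrysohn.totalMass g := by
  refine ⟨?_, ?_⟩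
  · obtain ⟨ψ, hψ, rfl⟩ := hf
    obtain ⟨φ, hφ⟩ := hψ.exists_isRotEpiSymm hn
    refine ⟨FunctionalUrysohn.expNeg φ, ⟨ψ, φ, hψ, rfl, hφ, rfl⟩, ?_⟩
    rintro g ⟨ψ', φ', hψ', hf, hφ', rfl⟩
    obtain rfl := hψ.eq_of_expNeg_eq hψ' hf
    rw [hφ'.unique hn hφ]
  · rintro g ⟨ψ, φ, hψ, rfl, hφ, rfl⟩
    exact ⟨hψ.integrable_expNeg, hφ.isConvC.integrable_expNeg,
      hφ.isConvC.totalMass_le hψ (hφ.lintegral_exp_neg_le hn hψ)⟩
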